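/- There is an algorithm which, given as input an integer $m\ge 2$, a finite list $R$ of words in the letters $a_1^{\pm1},\dots,a_m^{\pm1}$ and an integer $n\ge 0$, behaves as follows whenever the group $G=\langle a_1,\dots,a_m\mid R\rangle$ is hyperbolic (that is, its word metric with respect to $a_1,\dots,a_m$ is $\delta$-hyperbolic in the sense of Gromov for some $\delta$, which is not part of the input): it halts and outputs an integer $p$ with $|g-p/2^n|\le 2^{-n}$. Here $g$ is the growth exponent of the presentation, $$g=\lim_{L\to\infty}\frac1L\log_{2m-1}|B_L|,$$ where $B_L\subset G$ is the set of elements represented by words of length at most $L$; this limit exists. In other words, the growth exponent of a finite presentation of a hyperbolic group is computable, uniformly in the presentation. -/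

import Mathlib

open Filter Topology

namespace FinitePresentation

/-- A word in the letters `a₁^{±1}, …, a_m^{±1}`: `(i, true)` stands for the generator `a_i` and
`(i, false)` for its inverse, as in Mathlib's `FreeGroup`. -/
abbrev GenWord (m : ℕ) : Type := List (Fin m × Bool)

/-- The group `⟨a₁, …, a_m | R⟩`, for a finite list `R` of words. -/
abbrev Grp (m : ℕ) (R : List (GenWord m)) : Type :=
  PresentedGroup {r : FreeGroup (Fin m) | ∃ w ∈ R, FreeGroup.mk w = r}

/-- The element of `⟨a₁, …, a_m | R⟩` that a word represents. -/
def value {m : ℕ} (R : List (GenWord m)) (w : GenWord m) : Grp m R :=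
  PresentedGroup.mk _ (FreeGroup.mk w)

/-- The norm `‖x‖`: the least length of a word representing `x`. -/
noncomputable def wordNorm {m : ℕ} (R : List (GenWord m)) (x : Grp m R) : ℕ :=
  sInf {n : ℕ | ∃ w : GenWord m, value R w = x ∧ w.length = n}

/-- The Gromov product `(x, y) = (‖x‖ + ‖y‖ - ‖x⁻¹ y‖) / 2` at the neutral element. -/
noncomputable def gromovProduct {m : ℕ} (R : List (GenWord m)) (x y : Grp m R) : ℝ :=
  ((wordNorm R x : ℝ) + (wordNorm R y : ℝ) - (wordNorm R (x⁻¹ * y) : ℝ)) / 2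

/-- Gromov hyperbolicity of the word metric `d(x, y) = ‖x⁻¹ y‖` on `⟨a₁, …, a_m | R⟩`. As the
metric is left invariant, the neutral element suffices as a base point. -/
def IsHyperbolic {m : ℕ} (R : List (GenWord m)) : Prop :=
  ∃ δ : ℝ, ∀ x y z : Grp m R,
    min (gromovProduct R x y) (gromovProduct R y z) - δ ≤ gromovProduct R x z

/-- The ball `B_L`: the elements of norm at most `L`. -/
def ball {m : ℕ} (R : List (GenWord m)) (L : ℕ) : Set (Grp m R) :=
  {x | wordNorm R x ≤ L}

/-- `g` is the growth exponent of `⟨a₁, …, a_m | R⟩`: the limit, as `L → ∞`, of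
`(1 / L) * log_{2m-1} |B_L|`. -/
def HasGrowthExponent {m : ℕ} (R : List (GenWord m)) (g : ℝ) : Prop :=
  Tendsto (fun L : ℕ => 1 / (L : ℝ) * Real.logb (2 * (m : ℝ) - 1) ((ball R L).ncard : ℝ))
    atTop (𝓝 g)

/-- The finite description of a presentation that is handed to an algorithm: the number of
generators, and the relators with generators written as natural numbers. -/
def code {m : ℕ} (R : List (GenWord m)) : ℕ × List (List (ℕ × Bool)) :=
  (m, R.map fun w => w.map fun a => ((a.1 : ℕ), a.2))

/-- Every element is represented by a word, so that the norm is attained. -/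
theorem exists_word {m : ℕ} (R : List (GenWord m)) (x : Grp m R) :
    ∃ w : GenWord m, value R w = x ∧ w.length = wordNorm R x := by
  have h : {n : ℕ | ∃ w : GenWord m, value R w = x ∧ w.length = n}.Nonempty := by
    induction x using PresentedGroup.induction_on with
    | _ z => exact ⟨_, z.toWord, by simp [value, FreeGroup.mk_toWord], rfl⟩
  exact Nat.sInf_mem h

/-- Balls are finite, so that `Set.ncard` is their number of elements. -/
theorem finite_ball {m : ℕ} (R : List (GenWord m)) (L : ℕ) : (ball R L).Finite := by
  refine ((List.finite_length_le (Fin m × Bool) L).image (value R)).subset ?_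
  intro x hx
  obtain ⟨w, hw, hl⟩ := exists_word R x
  exact ⟨w, hl.le.trans hx, hw⟩

end FinitePresentation

/-! The algorithm searches through all finite certificates and outputs the number contained in the
first valid one. A certificate for `p` proves `(p - 1) / 2 ^ n ≤ g ≤ (p + 1) / 2 ^ n`. Its validity
is a primitive recursive condition that does not mention `δ`, and it is sound for every presentation
with `2 ≤ m`; hyperbolicity is needed only for the existence of a certificate.

Upper bound: the sizes of balls are submultiplicative, so by Fekete's lemma `log |B_L| / L` bounds
`g` from above for every `L > 0`. An upper bound for `|B_L|` is certified by derivations that carry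
every word of length `L` into a short list (`IsCover.ncard_ball_le`, `exists_isCover`).

Lower bound: here words have to be proved to represent distinct elements. The certificate contains
an automaton, a two-tape automaton describing multiplication by a letter, and finite data showing
that all such products exist and that every relator acts trivially. The group then acts on the
accepted words, and an accepted word is the image of the empty word under the element that it
represents; so accepted words of equal length represent different elements
(`IsCoherent.val_injective`). If `c` words of length `k` label loops at a reachable state, then `g ≥
log c / k` (`IsCoherent.loops_pow_le`, `HasGrowthExponent.logb_le`).

Existence: in a hyperbolic group shortlex words of adjacent elements fellow travel, so these words
form an automatic structure (`IsHyperbolic.fellowTravel`, `FellowTravel.path_iff`,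
`IsHyperbolic.exists_isCoherent`). Padded by a trivial letter, those of length `L` correspond to
`B_L`, and there are at least `β ^ L` of them for `β = (2m - 1) ^ g`. A finite automaton achieves
this only if for each `γ < β` with `1 ≤ γ` some state has more than `γ ^ k` loops of some length `k`
(`exists_loops`). -/

namespace FinitePresentation

/-! ### Letters, padded words and relators -/

/-- A letter `a_i^{±1}`, or the trivial letter `none`, which is used for padding. -/
abbrev Letter : Type := Option (ℕ × Bool)

abbrev Presentation : Type := ℕ × List (List (ℕ × Bool))

/-- The letters of a presentation with `m` generators, the trivial letter included. -/
def letters (m : ℕ) : List Letter :=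
  none :: (List.range m).flatMap fun i => [some (i, true), some (i, false)]

theorem none_mem_letters (m : ℕ) : (none : Letter) ∈ letters m := by simp [letters]

theorem some_mem_letters {m i : ℕ} {b : Bool} : (some (i, b) : Letter) ∈ letters m ↔ i < m := by
  cases b <;> simp [letters]

theorem nodup_letters (m : ℕ) : (letters m).Nodup := by
  unfold letters
  rw [List.nodup_cons]
  constructor
  · simp
  · rw [List.nodup_flatMap]
    refine ⟨fun i _ => by simp, ?_⟩
    refine List.nodup_range.imp ?_
    intro i j hij
    simp [Function.onFun, List.disjoint_left, hij]

/-- The inverse of a letter. -/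
def Letter.inv : Letter → Letter
  | none => none
  | some (i, b) => some (i, !b)

/-- The relators, the trivial letter and all products `a a⁻¹` of letters. -/
def relators (P : Presentation) : List (List Letter) :=
  [none] :: (P.2.map (List.map some) ++
    (List.range P.1).flatMap fun i =>
      [[some (i, true), some (i, false)], [some (i, false), some (i, true)]])

theorem mem_relators {P : Presentation} {r : List Letter} :
    r ∈ relators P ↔ r = [none] ∨ (∃ s ∈ P.2, s.map some = r) ∨
      ∃ i < P.1, ∃ b : Bool, r = [some (i, b), some (i, !b)] := by
  simp [relators, or_comm]

/-- All words of length `L`. -/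
def allWords (m : ℕ) : ℕ → List (List Letter)
  | 0 => [[]]
  | L + 1 => (allWords m L).flatMap fun w => (letters m).map fun x => x :: w

theorem mem_allWords {m L : ℕ} {w : List Letter} :
    w ∈ allWords m L ↔ w.length = L ∧ ∀ x ∈ w, x ∈ letters m := by
  induction L generalizing w with
  | zero => simp +contextual [allWords]
  | succ L ih =>
    rcases w with _ | ⟨x, w⟩
    · simp [allWords]
    · simp [allWords, ih]
      tauto

theorem nodup_allWords (m L : ℕ) : (allWords m L).Nodup := by
  induction L with
  | zero => simp [allWords]
  | succ L ih =>
    rw [allWords, List.nodup_flatMap]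
    refine ⟨fun w _ => (nodup_letters m).map fun x y h => by simpa using h, ih.imp ?_⟩
    intro u v huv
    simp only [Function.onFun, List.disjoint_left, List.mem_map]
    rintro _ ⟨x, _, rfl⟩ ⟨y, _, h⟩
    simp at h
    exact huv h.2.symm

/-! ### Values of words and elementary properties of the norm -/

section Values

variable {m : ℕ} (R : List (GenWord m))

/-- The element that a letter represents. -/
def gen : Letter → Grp m R
  | none => 1
  | some (i, b) => if h : i < m then value R [(⟨i, h⟩, b)] else 1

/-- The element that a word represents. -/
def fwd (w : List Letter) : Grp m R := (w.map (gen R)).prod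

/-- The element that a word represents when it is read from right to left. -/
def val : List Letter → Grp m R
  | [] => 1
  | x :: w => val w * gen R x

/-- The word over `Letter` that corresponds to a word in the generators. -/
def ofGenWord (w : GenWord m) : List Letter := w.map fun a => some ((a.1 : ℕ), a.2)

theorem value_append (u v : GenWord m) : value R (u ++ v) = value R u * value R v := by
  simp [value, ← FreeGroup.mul_mk]

theorem value_cons (a : Fin m × Bool) (v : GenWord m) :
    value R (a :: v) = value R [a] * value R v := value_append R [a] v

theorem value_nil : value R [] = 1 := by
  simp [value, ← FreeGroup.one_eq_mk]

theorem fwd_append (u v : List Letter) : fwd R (u ++ v) = fwd R u * fwd R v := by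
  simp [fwd]

theorem fwd_cons (x : Letter) (v : List Letter) : fwd R (x :: v) = gen R x * fwd R v := by
  simp [fwd]

theorem fwd_nil : fwd R [] = 1 := rfl

theorem val_append (u v : List Letter) : val R (u ++ v) = val R v * val R u := by
  induction u with
  | nil => simp [val]
  | cons x u ih => simp [val, ih, mul_assoc]

theorem val_reverse (w : List Letter) : val R w.reverse = fwd R w := by
  induction w with
  | nil => rfl
  | cons x w ih => simp [val_append, ih, fwd_cons, val]

theorem fwd_ofGenWord (w : GenWord m) : fwd R (ofGenWord w) = value R w := by
  induction w with
  | nil => simp [ofGenWord, fwd_nil, value_nil]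
  | cons a w ih =>
    rw [value_cons, ← ih]
    simp [ofGenWord, fwd_cons, gen]

theorem ofGenWord_valid (w : GenWord m) : ∀ x ∈ ofGenWord w, x ∈ letters m := by
  intro x hx
  simp only [ofGenWord, List.mem_map] at hx
  obtain ⟨a, _, rfl⟩ := hx
  exact some_mem_letters.2 a.1.2

theorem gen_inv (x : Letter) : gen R (Letter.inv x) = (gen R x)⁻¹ := by
  rcases x with _ | ⟨i, b⟩
  · simp [gen, Letter.inv]
  · by_cases h : i < m
    · simp only [gen, Letter.inv, h, dite_true]
      rw [eq_inv_iff_mul_eq_one, ← value_append]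
      have h1 : FreeGroup.mk [((⟨i, h⟩ : Fin m), !b), (⟨i, h⟩, b)] = FreeGroup.mk [] :=
        Quot.sound FreeGroup.Red.Step.cons_not_rev
      rw [List.singleton_append, value, h1]
      exact value_nil R
    · simp [gen, Letter.inv, h]

theorem value_relator {r : GenWord m} (hr : r ∈ R) : value R r = 1 := by
  rw [value]
  exact PresentedGroup.one_of_mem ⟨r, hr, rfl⟩

theorem fwd_relator {r : List Letter} (hr : r ∈ relators (code R)) : fwd R r = 1 := by
  rcases mem_relators.1 hr with rfl | ⟨s, hs, rfl⟩ | ⟨i, _, b, rfl⟩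
  · simp [fwd, gen]
  · simp only [code, List.mem_map] at hs
    obtain ⟨w, hw, rfl⟩ := hs
    rw [List.map_map]
    exact (fwd_ofGenWord R w).trans (value_relator R hw)
  · have := gen_inv R (some (i, b))
    simp [fwd, Letter.inv] at this ⊢
    simp [this]

/-- A word over `Letter` gives a word in the generators with the same value. -/
theorem exists_value_eq_fwd (w : List Letter) :
    ∃ u : GenWord m, value R u = fwd R w ∧ u.length ≤ w.length := by
  induction w with
  | nil => exact ⟨[], by simp [value_nil, fwd_nil]⟩
  | cons x w ih =>
    obtain ⟨u, hu, hl⟩ := ih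
    have triv : gen R x = 1 → ∃ u : GenWord m, value R u = fwd R (x :: w) ∧
        u.length ≤ (x :: w).length := fun h =>
      ⟨u, by rw [fwd_cons, h, one_mul, hu], hl.trans (by simp)⟩
    rcases x with _ | ⟨i, b⟩
    · exact triv rfl
    · by_cases h : i < m
      · refine ⟨(⟨i, h⟩, b) :: u, ?_, by simpa using hl⟩
        rw [value_cons, fwd_cons, hu]
        simp [gen, h]
      · exact triv (by simp [gen, h])

theorem wordNorm_value_le (w : GenWord m) : wordNorm R (value R w) ≤ w.length :=
  Nat.sInf_le ⟨w, rfl, rfl⟩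

theorem wordNorm_fwd_le (w : List Letter) : wordNorm R (fwd R w) ≤ w.length := by
  obtain ⟨u, hu, hl⟩ := exists_value_eq_fwd R w
  rw [← hu]
  exact (wordNorm_value_le R u).trans hl

theorem wordNorm_val_le (w : List Letter) : wordNorm R (val R w) ≤ w.length := by
  have := wordNorm_fwd_le R w.reverse
  rwa [← val_reverse, List.reverse_reverse, List.length_reverse] at this

theorem wordNorm_one : wordNorm R (1 : Grp m R) = 0 :=
  Nat.le_zero.1 (wordNorm_fwd_le R [])

theorem wordNorm_mul_le (x y : Grp m R) : wordNorm R (x * y) ≤ wordNorm R x + wordNorm R y := by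
  obtain ⟨u, rfl, hu⟩ := exists_word R x
  obtain ⟨v, rfl, hv⟩ := exists_word R y
  rw [← value_append, ← hu, ← hv]
  exact (wordNorm_value_le R _).trans (by simp)

/-- Elements of norm at most `n` are represented by padded words of length `n`. -/
theorem exists_val_eq {x : Grp m R} {n : ℕ} (h : wordNorm R x ≤ n) :
    ∃ w : List Letter, w.length = n ∧ (∀ a ∈ w, a ∈ letters m) ∧ val R w = x := by
  obtain ⟨u, rfl, hu⟩ := exists_word R x
  refine ⟨(ofGenWord u).reverse ++ List.replicate (n - u.length) none, ?_, ?_, ?_⟩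
  · simp [ofGenWord]; omega
  · intro a ha
    rcases List.mem_append.1 ha with ha | ha
    · exact ofGenWord_valid u a (List.mem_reverse.1 ha)
    · rw [List.eq_of_mem_replicate ha]; exact none_mem_letters m
  · have : ∀ k, val R (List.replicate k none) = 1 := fun k => by
      induction k with
      | zero => rfl
      | succ k ih => simp [List.replicate_succ, val, ih, gen]
    rw [val_append, this, one_mul, val_reverse, fwd_ofGenWord]

theorem fwd_reverse_inv (w : List Letter) :
    fwd R (w.map Letter.inv).reverse = (fwd R w)⁻¹ := by
  induction w with
  | nil => simp [fwd_nil]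
  | cons x w ih => simp [fwd_append, ih, fwd_cons, gen_inv, fwd_nil]

theorem wordNorm_inv_le (x : Grp m R) : wordNorm R x⁻¹ ≤ wordNorm R x := by
  obtain ⟨u, rfl, hu⟩ := exists_word R x
  rw [← hu, ← fwd_ofGenWord, ← fwd_reverse_inv]
  exact (wordNorm_fwd_le R _).trans (by simp [ofGenWord])

theorem wordNorm_inv (x : Grp m R) : wordNorm R x⁻¹ = wordNorm R x :=
  (wordNorm_inv_le R x).antisymm (by simpa using wordNorm_inv_le R x⁻¹)

end Values

/-! ### Automata, two-tape automata and coherence -/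

section Automata

abbrev Moves : Type := List (ℕ × Letter × ℕ)
abbrev Tracks : Type := List (List Letter × Letter × Letter × List Letter)
abbrev Claims : Type := List (List Letter × ℕ)

/-- `Path δ q w p`: the automaton with transitions `δ` can go from `q` to `p` reading `w` from
right to left. -/
inductive Path (δ : Moves) (q : ℕ) : List Letter → ℕ → Prop
  | nil : Path δ q [] q
  | cons {u : List Letter} {p p' : ℕ} {x : Letter} :
      Path δ q u p → (p, x, p') ∈ δ → Path δ q (x :: u) p'

/-- `Track T u l v`: the two-tape automaton with transitions `T` can reach the state `l` when it
reads `u` and `v` synchronously from right to left. -/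
inductive Track (T : Tracks) : List Letter → List Letter → List Letter → Prop
  | nil : Track T [] [none] []
  | cons {u v l l' : List Letter} {x y : Letter} :
      Track T u l v → (l, x, y, l') ∈ T → Track T (x :: u) l' (y :: v)

/-- A sequence of words, beginning with the first and ending with the last argument, in which
neighbours track each other; `t` lists the states of the automata involved. -/
def Chain (δ : Moves) (T : Tracks) (q₀ : ℕ) :
    List Letter → Claims → List Letter → Prop
  | u, [], v => u = v
  | u, (l, q) :: t, v => ∃ u', Path δ q₀ u' q ∧ Track T u l u' ∧ Chain δ T q₀ u' t v

/-- One transition of the automaton that recognizes chains. -/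
def lifts (m : ℕ) (δ : Moves) (T : Tracks) : Claims → List (Letter × Claims × Letter)
  | [] => (letters m).map fun z => (z, [], z)
  | c :: t => (lifts m δ T t).flatMap fun f => δ.flatMap fun d => T.filterMap fun s =>
      if d.1 = c.2 ∧ d.2.1 = f.1 ∧ s.1 = c.1 ∧ s.2.2.1 = f.1 then
        some (s.2.1, (s.2.2.2, d.2.2) :: f.2.1, f.2.2) else none

theorem mem_lifts_cons {m : ℕ} {δ : Moves} {T : Tracks} {l : List Letter} {q : ℕ} {t t' : Claims}
    {x z : Letter} :
    (x, t', z) ∈ lifts m δ T ((l, q) :: t) ↔ ∃ y l' q' s, t' = (l', q') :: s ∧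
      (y, s, z) ∈ lifts m δ T t ∧ (q, y, q') ∈ δ ∧ (l, x, y, l') ∈ T := by
  simp only [lifts, List.mem_flatMap, List.mem_filterMap]
  constructor
  · rintro ⟨⟨y, s, z'⟩, hf, ⟨q₁, y₁, q'⟩, hd, ⟨l₁, x', y₂, l'⟩, hs, h⟩
    split_ifs at h with hc
    obtain ⟨rfl, rfl, rfl, rfl⟩ := hc
    simp only [Option.some.injEq, Prod.mk.injEq] at h
    obtain ⟨rfl, rfl, rfl⟩ := h
    exact ⟨_, _, _, _, rfl, hf, hd, hs⟩
  · rintro ⟨y, l', q', s, rfl, hf, hd, hs⟩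
    exact ⟨_, hf, _, hd, _, hs, by simp⟩

/-- The letter read last is removed from all words of the chain at once. Together with
`Chain.of_lift` this makes `lifts` the transition relation on chains, so that statements about all
chains reduce to finitely many checks. -/
theorem Chain.exists_lift {m : ℕ} {δ : Moves} {T : Tracks} {q₀ : ℕ}
    (hδ : ∀ d ∈ δ, d.2.1 ∈ letters m) {x : Letter} {u v' : List Letter} {t' : Claims}
    (hx : x ∈ letters m) (h : Chain δ T q₀ (x :: u) t' v') :
    ∃ z v t, v' = z :: v ∧ Chain δ T q₀ u t v ∧ (x, t', z) ∈ lifts m δ T t := by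
  induction t' generalizing x u with
  | nil => exact ⟨x, u, [], h.symm, rfl, by simpa [lifts] using hx⟩
  | cons c t' ih =>
    obtain ⟨l', q'⟩ := c
    obtain ⟨_, hp, ht, hc⟩ := h
    cases ht with
    | cons ht hT =>
      cases hp with
      | cons hp hd =>
        obtain ⟨z, v, t, rfl, hc', hl⟩ := ih (hδ _ hd) hc
        exact ⟨z, v, _ :: t, rfl, ⟨_, hp, ht, hc'⟩,
          mem_lifts_cons.2 ⟨_, _, _, _, rfl, hl, hd, hT⟩⟩

theorem Chain.of_lift {m : ℕ} {δ : Moves} {T : Tracks} {q₀ : ℕ} {x z : Letter}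
    {u v : List Letter} {t t' : Claims} (h : Chain δ T q₀ u t v)
    (hl : (x, t', z) ∈ lifts m δ T t) : Chain δ T q₀ (x :: u) t' (z :: v) := by
  induction t generalizing x u t' with
  | nil =>
    simp only [lifts, List.mem_map, Prod.mk.injEq] at hl
    obtain ⟨_, _, rfl, rfl, rfl⟩ := hl
    exact congrArg _ h
  | cons c t ih =>
    obtain ⟨l, q⟩ := c
    obtain ⟨u', hp, ht, hc⟩ := h
    obtain ⟨y, l', q', s, rfl, hf, hd, hT⟩ := mem_lifts_cons.1 hl
    exact ⟨y :: u', hp.cons hd, ht.cons hT, ih hc hf⟩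

theorem Track.length_eq {T : Tracks} {u l v : List Letter} (h : Track T u l v) :
    u.length = v.length := by
  induction h with
  | nil => rfl
  | cons _ _ ih => simp [ih]

theorem Path.valid {m : ℕ} {δ : Moves} (hδ : ∀ d ∈ δ, d.2.1 ∈ letters m) {q p : ℕ}
    {w : List Letter} (h : Path δ q w p) : ∀ x ∈ w, x ∈ letters m := by
  induction h with
  | nil => simp
  | cons _ hd ih => exact List.forall_mem_cons.2 ⟨hδ _ hd, ih⟩

theorem Path.append {δ : Moves} {q p r : ℕ} {u v : List Letter} (h : Path δ q u p)
    (h' : Path δ p v r) : Path δ q (v ++ u) r := by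
  induction h' with
  | nil => exact h
  | cons _ hd ih => exact ih.cons hd

/-- The states that can be reached from `q` by reading a word. -/
def endpoints (δ : Moves) (q : ℕ) (w : List Letter) : List ℕ :=
  w.foldr (fun x S => S.flatMap fun p => δ.filterMap fun d =>
    if d.1 = p ∧ d.2.1 = x then some d.2.2 else none) [q]

theorem mem_endpoints {δ : Moves} {q p : ℕ} {w : List Letter} :
    p ∈ endpoints δ q w ↔ Path δ q w p := by
  induction w generalizing p with
  | nil =>
    simp only [endpoints, List.foldr_nil, List.mem_singleton]
    exact ⟨fun h => h ▸ .nil, fun h => by cases h; rfl⟩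
  | cons x w ih =>
    rw [endpoints, List.foldr_cons, ← endpoints]
    simp only [List.mem_flatMap, List.mem_filterMap, ih]
    constructor
    · rintro ⟨p', hp, ⟨p₁, y, p₂⟩, hd, h⟩
      split_ifs at h with hc
      obtain ⟨rfl, rfl⟩ := hc
      cases h
      exact hp.cons hd
    · intro h
      cases h with
      | cons hp hd => exact ⟨_, hp, _, hd, by simp⟩

/-- The words of length `k` that label loops at `q`. -/
def loops (m : ℕ) (δ : Moves) (q k : ℕ) : List (List Letter) :=
  (allWords m k).filter fun w => decide (q ∈ endpoints δ q w)

theorem mem_loops {m : ℕ} {δ : Moves} {q k : ℕ} {w : List Letter} :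
    w ∈ loops m δ q k ↔ (w.length = k ∧ ∀ x ∈ w, x ∈ letters m) ∧ Path δ q w q := by
  rw [loops, List.mem_filter, mem_allWords, decide_eq_true_iff, mem_endpoints]

/-- Claims about the words that track a given word are inherited when a letter is appended. -/
def Justified (m : ℕ) (δ : Moves) (T : Tracks) (C : Claims) (x : Letter) (C' : Claims) : Prop :=
  ∀ c' ∈ C', ∃ c ∈ C, ∃ y ∈ letters m, (c.1, x, y, c'.1) ∈ T ∧ (c.2, y, c'.2) ∈ δ

/-- The finitely many conditions under which the words accepted by the automaton `δ` carry an
action of the group. -/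
structure IsCoherent (P : Presentation) (q₀ : ℕ) (δ : Moves) (T : Tracks)
    (N : List (ℕ × Claims)) (Ω : List (ℕ × Claims × Bool)) : Prop where
  -- Trivial letters read at the beginning do not leave the initial state, so padding preserves
  -- acceptance.
  pad : (q₀, none, q₀) ∈ δ
  valid : ∀ d ∈ δ, d.2.1 ∈ letters P.1
  -- On the tapes `w ++ [none]` and `x :: w` the second is one letter ahead, and the state remembers
  -- this letter. Thus appending a letter is an instance of multiplication by it.
  shift : ∀ x ∈ letters P.1, ∀ y ∈ letters P.1, ([x], x, y, [y]) ∈ T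
  -- A claim `(l, p)` attached to a state reached by `w` asserts that `w ++ [none]` tracks, with
  -- final state `l`, some word leading to `p`. With `total`, every accepted word has a product with
  -- every letter.
  claims_init : ∃ c ∈ N, c.1 = q₀ ∧ Justified P.1 δ T [([none], q₀)] none c.2
  claims_step : ∀ c ∈ N, ∀ d ∈ δ, d.1 = c.1 →
    ∃ c' ∈ N, c'.1 = d.2.2 ∧ Justified P.1 δ T c.2 d.2.1 c'.2
  total : ∀ c ∈ N, ∀ x ∈ letters P.1, ∃ a ∈ c.2, a.1 = [x]
  -- For every chain as long as a relator, `Ω` contains the state of its first word, the states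
  -- along it, and whether its first and last words agree. By `closed`, multiplying successively by
  -- the letters of a relator leads back to the start.
  chains_init : ∀ r ∈ relators P, (q₀, r.map (fun _ => ([none], q₀)), true) ∈ Ω
  chains_step : ∀ o ∈ Ω, ∀ d ∈ δ, d.1 = o.1 → ∀ f ∈ lifts P.1 δ T o.2.1, f.1 = d.2.1 →
    (d.2.2, f.2.1, (o.2.2 && decide (f.1 = f.2.2))) ∈ Ω
  closed : ∀ o ∈ Ω, ∀ r ∈ relators P, o.2.1.map Prod.fst = r.map (fun a => [a]) → o.2.2 = true

end Automata

/-! ### Coherent data define multiplication of accepted words by letters -/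

section Soundness

variable {P : Presentation} {q₀ : ℕ} {δ : Moves} {T : Tracks} {N : List (ℕ × Claims)}
  {Ω : List (ℕ × Claims × Bool)}

theorem IsCoherent.path_pad (h : IsCoherent P q₀ δ T N Ω) {w : List Letter} {q : ℕ}
    (hw : Path δ q₀ w q) (n : ℕ) : Path δ q₀ (w ++ List.replicate n none) q := by
  refine Path.append ?_ hw
  induction n with
  | zero => exact .nil
  | succ n ih => exact ih.cons h.pad

theorem IsCoherent.track_pad (h : IsCoherent P q₀ δ T N Ω) {u l v : List Letter}
    (hw : Track T u l v) (n : ℕ) :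
    Track T (u ++ List.replicate n none) l (v ++ List.replicate n none) := by
  induction hw with
  | nil =>
    induction n with
    | zero => exact .nil
    | succ n ih =>
      exact ih.cons (h.shift _ (none_mem_letters _) _ (none_mem_letters _))
  | cons _ ht ih => exact ih.cons ht

theorem IsCoherent.track_shift (h : IsCoherent P q₀ δ T N Ω) {w : List Letter} {x : Letter}
    (hw : ∀ y ∈ w, y ∈ letters P.1) (hx : x ∈ letters P.1) :
    Track T (w ++ [none]) [x] (x :: w) := by
  induction w generalizing x with
  | nil => exact Track.nil.cons (h.shift _ (none_mem_letters _) _ hx)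
  | cons y w ih =>
    have hy := hw y (by simp)
    exact (ih (fun z hz => hw z (by simp [hz])) hy).cons (h.shift _ hy _ hx)

theorem IsCoherent.exists_claims (h : IsCoherent P q₀ δ T N Ω) {w : List Letter} {q : ℕ}
    (hw : Path δ q₀ w q) : ∃ c ∈ N, c.1 = q ∧
      ∀ a ∈ c.2, ∃ v, Path δ q₀ v a.2 ∧ Track T (w ++ [none]) a.1 v := by
  induction hw with
  | nil =>
    obtain ⟨c, hc, rfl, hC⟩ := h.claims_init
    refine ⟨c, hc, rfl, fun a ha => ?_⟩
    obtain ⟨b, hb, y, -, hT, hd⟩ := hC a ha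
    rw [List.mem_singleton] at hb
    subst hb
    exact ⟨[y], Path.nil.cons hd, Track.nil.cons hT⟩
  | cons _ hd ih =>
    obtain ⟨c, hc, rfl, hC⟩ := ih
    obtain ⟨c', hc', hq, hJ⟩ := h.claims_step c hc _ hd rfl
    refine ⟨c', hc', hq, fun a ha => ?_⟩
    obtain ⟨b, hb, y, -, hT, hd'⟩ := hJ a ha
    obtain ⟨v, hv, ht⟩ := hC b hb
    exact ⟨y :: v, hv.cons hd', ht.cons hT⟩

theorem IsCoherent.exists_track (h : IsCoherent P q₀ δ T N Ω) {w : List Letter} {q : ℕ}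
    (hw : Path δ q₀ w q) {x : Letter} (hx : x ∈ letters P.1) :
    ∃ v p, Path δ q₀ v p ∧ Track T (w ++ [none]) [x] v := by
  obtain ⟨c, hc, -, hC⟩ := h.exists_claims hw
  obtain ⟨a, ha, rfl'⟩ := h.total c hc x hx
  obtain ⟨v, hv, ht⟩ := hC a ha
  exact ⟨v, _, hv, rfl' ▸ ht⟩

theorem length_of_mem_lifts {m : ℕ} {s t : Claims} {x z : Letter}
    (h : (x, t, z) ∈ lifts m δ T s) : s.length = t.length := by
  induction s generalizing t x with
  | nil =>
    simp only [lifts, List.mem_map, Prod.mk.injEq] at h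
    obtain ⟨_, _, _, rfl, _⟩ := h
    rfl
  | cons c s ih =>
    obtain ⟨y, l', q', s', rfl, hf, -, -⟩ := mem_lifts_cons.1 h
    simp [ih hf]

/-- Induction on the first word: over the empty word there is only the chain of empty words,
supplied by `chains_init`, and each further letter is a transition of `lifts`, covered by
`chains_step`. -/
theorem IsCoherent.chain_mem (h : IsCoherent P q₀ δ T N Ω) {r : List Letter}
    (hr : r ∈ relators P) {u v : List Letter} {t : Claims} {q : ℕ} (hu : Path δ q₀ u q)
    (hc : Chain δ T q₀ u t v) (ht : t.length = r.length) : (q, t, decide (u = v)) ∈ Ω := by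
  induction hu generalizing v t with
  | nil =>
    have key : ∀ (t : Claims) (v : List Letter), Chain δ T q₀ [] t v →
        v = [] ∧ t = List.replicate t.length ([none], q₀) := by
      intro t
      induction t with
      | nil => exact fun v hv => ⟨hv.symm, rfl⟩
      | cons c t ih =>
        obtain ⟨l, p⟩ := c
        rintro v ⟨u', hp, ht, hc⟩
        cases ht
        cases hp
        obtain ⟨rfl, ht'⟩ := ih v hc
        refine ⟨rfl, ?_⟩
        rw [List.length_cons, List.replicate_succ, ← ht']
    obtain ⟨rfl, ht'⟩ := key t v hc
    have := h.chains_init r hr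
    rw [List.map_const', ← ht, ← ht'] at this
    simpa using this
  | cons hu hd ih =>
    obtain ⟨z, v, s, rfl, hc', hl⟩ := hc.exists_lift h.valid (h.valid _ hd)
    have hlen : s.length = t.length := length_of_mem_lifts hl
    have := h.chains_step _ (ih hc' (hlen.trans ht)) _ hd rfl _ hl rfl
    convert this using 3
    simp [Bool.decide_and, Bool.and_comm]

theorem IsCoherent.chain_closed (h : IsCoherent P q₀ δ T N Ω) {r : List Letter}
    (hr : r ∈ relators P) {u v : List Letter} {t : Claims} {q : ℕ} (hu : Path δ q₀ u q)
    (hc : Chain δ T q₀ u t v) (ht : t.map Prod.fst = r.map (fun a => [a])) : u = v := by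
  have hl : t.length = r.length := by simpa using congrArg List.length ht
  simpa using h.closed _ (h.chain_mem hr hu hc hl) r hr ht

/-- A word, read from right to left and padded by the trivial letter. -/
def padded (w : List Letter) (i : ℕ) : Letter := w.getD i none

/-- The first `M` letters of a padded word. -/
def trunc (M : ℕ) (f : ℕ → Letter) : List Letter := (List.range M).map f

theorem trunc_padded {M : ℕ} {w : List Letter} (h : w.length ≤ M) :
    trunc M (padded w) = w ++ List.replicate (M - w.length) none := by
  apply List.ext_getElem
  · simp [trunc]; omega
  · intro i h1 h2
    simp only [trunc, padded, List.getElem_map, List.getElem_range, List.getElem_append,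
      List.getElem_replicate, List.getD_eq_getElem?_getD]
    split_ifs with hi
    · simp [hi]
    · simp [List.getElem?_eq_none (not_lt.1 hi)]

theorem padded_append (w : List Letter) (n : ℕ) :
    padded (w ++ List.replicate n none) = padded w := by
  funext i
  simp only [padded, List.getD_eq_getElem?_getD, List.getElem?_append]
  split_ifs with hi
  · rfl
  · rw [List.getElem?_eq_none (not_lt.1 hi), List.getElem?_replicate]
    split_ifs <;> rfl

theorem padded_injective {u v : List Letter} (hl : u.length = v.length)
    (h : padded u = padded v) : u = v := by
  have := congrArg (trunc u.length) h
  rw [trunc_padded le_rfl, trunc_padded hl.ge] at this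
  simpa [hl] using this

/-- The padded words that the automaton accepts. -/
def Accepted (δ : Moves) (q₀ : ℕ) : Type :=
  -- Multiplication lengthens a word by one letter, so a relator could never return to the same
  -- finite word; infinite padded sequences forget the length.
  {f : ℕ → Letter // ∃ w q, Path δ q₀ w q ∧ f = padded w}

def Accepted.mk {w : List Letter} {q : ℕ} (h : Path δ q₀ w q) : Accepted δ q₀ :=
  ⟨padded w, w, q, h, rfl⟩

/-- `g` is obtained from `f` by multiplication with the letter `x`. -/
def Next (T : Tracks) (x : Letter) (f g : ℕ → Letter) : Prop :=
  ∀ᶠ M in atTop, Track T (trunc M f) [x] (trunc M g)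

theorem IsCoherent.next_of_track (h : IsCoherent P q₀ δ T N Ω) {u v : List Letter} {x : Letter}
    (ht : Track T u [x] v) : Next T x (padded u) (padded v) := by
  filter_upwards [eventually_ge_atTop u.length] with M hM
  rw [trunc_padded hM, trunc_padded (ht.length_eq ▸ hM), ← ht.length_eq]
  exact h.track_pad ht _

theorem IsCoherent.exists_next (h : IsCoherent P q₀ δ T N Ω) (f : Accepted δ q₀) {x : Letter}
    (hx : x ∈ letters P.1) : ∃ g : Accepted δ q₀, Next T x f.1 g.1 := by
  obtain ⟨_, w, q, hw, rfl⟩ := f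
  obtain ⟨v, p, hv, ht⟩ := h.exists_track hw hx
  refine ⟨.mk hv, ?_⟩
  have := h.next_of_track ht
  rwa [show [none] = List.replicate 1 (none : Letter) from rfl, padded_append] at this

/-- Multiplication by a sequence of letters. -/
def NextList (T : Tracks) : List Letter → Accepted δ q₀ → Accepted δ q₀ → Prop
  | [], f, g => f = g
  | x :: r, f, g => ∃ f' : Accepted δ q₀, Next T x f.1 f'.1 ∧ NextList T r f' g

theorem IsCoherent.eventually_path (h : IsCoherent P q₀ δ T N Ω) (f : Accepted δ q₀) :
    ∀ᶠ M in atTop, ∃ q, Path δ q₀ (trunc M f.1) q := by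
  obtain ⟨_, w, q, hw, rfl⟩ := f
  filter_upwards [eventually_ge_atTop w.length] with M hM
  exact ⟨q, by rw [trunc_padded hM]; exact h.path_pad hw _⟩

theorem IsCoherent.eventually_chain (h : IsCoherent P q₀ δ T N Ω) {r : List Letter}
    {f g : Accepted δ q₀} (hc : NextList T r f g) :
    ∀ᶠ M in atTop, ∃ t : Claims, t.map Prod.fst = r.map (fun a => [a]) ∧
      Chain δ T q₀ (trunc M f.1) t (trunc M g.1) := by
  induction r generalizing f with
  | nil => exact .of_forall fun M => ⟨[], rfl, by rw [show f = g from hc]; rfl⟩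
  | cons x r ih =>
    obtain ⟨f', hn, hc⟩ := hc
    filter_upwards [hn, h.eventually_path f', ih hc] with M h1 h2 h3
    obtain ⟨q, hq⟩ := h2
    obtain ⟨t, ht, hc⟩ := h3
    exact ⟨([x], q) :: t, by simp [ht], _, hq, h1, hc⟩

theorem Accepted.ext_trunc {f g : Accepted δ q₀}
    (h : ∀ᶠ M in atTop, trunc M f.1 = trunc M g.1) : f = g := by
  refine Subtype.ext (funext fun i => ?_)
  obtain ⟨M, hM, hi⟩ := (h.and (eventually_gt_atTop i)).exists
  have := congrArg (fun l => l.getD i none) hM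
  simpa [trunc, hi] using this

theorem IsCoherent.nextList_closed (h : IsCoherent P q₀ δ T N Ω) {r : List Letter}
    (hr : r ∈ relators P) {f g : Accepted δ q₀} (hc : NextList T r f g) : f = g := by
  refine Accepted.ext_trunc ?_
  filter_upwards [h.eventually_path f, h.eventually_chain hc] with M h1 h2
  obtain ⟨q, hq⟩ := h1
  obtain ⟨t, ht, hc⟩ := h2
  exact h.chain_closed hr hq hc ht

open Classical in
/-- The multiplication of accepted words by a letter. -/
noncomputable def IsCoherent.mul (h : IsCoherent P q₀ δ T N Ω) (x : Letter)
    (f : Accepted δ q₀) : Accepted δ q₀ :=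
  if hx : x ∈ letters P.1 then (h.exists_next f hx).choose else f

theorem IsCoherent.next_mul (h : IsCoherent P q₀ δ T N Ω) {x : Letter} (hx : x ∈ letters P.1)
    (f : Accepted δ q₀) : Next T x f.1 (h.mul x f).1 := by
  rw [mul, dif_pos hx]
  exact (h.exists_next f hx).choose_spec

theorem IsCoherent.foldl_mul (h : IsCoherent P q₀ δ T N Ω) {r : List Letter}
    (hr : r ∈ relators P) (hv : ∀ x ∈ r, x ∈ letters P.1) (f : Accepted δ q₀) :
    r.foldl (fun f x => h.mul x f) f = f := by
  refine (h.nextList_closed hr ?_).symm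
  clear hr
  induction r generalizing f with
  | nil => rfl
  | cons x r ih =>
    exact ⟨_, h.next_mul (hv x (by simp)) f, ih (fun y hy => hv y (by simp [hy])) _⟩

theorem IsCoherent.mul_inv_mul (h : IsCoherent P q₀ δ T N Ω) {i : ℕ} (hi : i < P.1) (b : Bool)
    (f : Accepted δ q₀) : h.mul (some (i, !b)) (h.mul (some (i, b)) f) = f := by
  refine h.foldl_mul (r := [some (i, b), some (i, !b)])
    (mem_relators.2 (.inr (.inr ⟨i, hi, b, rfl⟩))) ?_ f
  simp [some_mem_letters, hi]

/-- Products are unique although `T` may be nondeterministic. If `g` is a product of `f` by `x`, the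
relator `x x⁻¹` forces `f` to be the product of `g` by `x⁻¹`, and multiplying back by `x` gives `g`.
For the trivial letter the relator `[none]` does the same. -/
theorem IsCoherent.mul_eq_of_next (h : IsCoherent P q₀ δ T N Ω) {x : Letter}
    (hx : x ∈ letters P.1) {f g : Accepted δ q₀} (hn : Next T x f.1 g.1) : h.mul x f = g := by
  rcases x with _ | ⟨i, b⟩
  · have h1 := h.nextList_closed (mem_relators.2 (.inl rfl)) (f := f) (g := g) ⟨g, hn, rfl⟩
    rw [← h1]
    exact h.foldl_mul (r := [none]) (mem_relators.2 (.inl rfl)) (by simpa using hx) f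
  · have hi := some_mem_letters.1 hx
    have h1 : f = h.mul (some (i, !b)) g :=
      h.nextList_closed (r := [some (i, b), some (i, !b)])
        (mem_relators.2 (.inr (.inr ⟨i, hi, b, rfl⟩)))
        ⟨g, hn, _, h.next_mul (some_mem_letters.2 hi) g, rfl⟩
    rw [h1]
    simpa using h.mul_inv_mul hi (!b) g

end Soundness

/-! ### The action of the group on accepted words, and the lower bound from loops -/

section Action

variable {m : ℕ} {R : List (GenWord m)} {q₀ : ℕ} {δ : Moves} {T : Tracks}
  {N : List (ℕ × Claims)} {Ω : List (ℕ × Claims × Bool)}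

/-- Multiplication by a generator, as a permutation of the accepted words. -/
noncomputable def IsCoherent.perm (h : IsCoherent (code R) q₀ δ T N Ω) (i : Fin m) :
    Equiv.Perm (Accepted δ q₀) where
  toFun := h.mul (some (i, true))
  invFun := h.mul (some (i, false))
  left_inv f := h.mul_inv_mul i.2 true f
  right_inv f := h.mul_inv_mul i.2 false f

/-- The right action of the free group on the accepted words. -/
noncomputable def IsCoherent.freeAction (h : IsCoherent (code R) q₀ δ T N Ω) :
    FreeGroup (Fin m) →* (Equiv.Perm (Accepted δ q₀))ᵐᵒᵖ :=
  FreeGroup.lift fun i => .op (h.perm i)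

theorem IsCoherent.freeAction_mk (h : IsCoherent (code R) q₀ δ T N Ω) (w : GenWord m)
    (f : Accepted δ q₀) : (h.freeAction (FreeGroup.mk w)).unop f =
      (ofGenWord w).foldl (fun f x => h.mul x f) f := by
  induction w generalizing f with
  | nil => simp [ofGenWord, ← FreeGroup.one_eq_mk]
  | cons a w ih =>
    rw [← List.singleton_append, ← FreeGroup.mul_mk, map_mul, MulOpposite.unop_mul,
      Equiv.Perm.mul_apply, ih]
    obtain ⟨i, b⟩ := a
    have : (h.freeAction (FreeGroup.mk [(i, b)])).unop f = h.mul (some (i, b)) f := by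
      cases b
      · simp [freeAction, FreeGroup.lift_mk]
        rfl
      · simp [freeAction, FreeGroup.lift_mk]
        rfl
    rw [this]
    simp [ofGenWord]

/-- The right action of the group on the accepted words. -/
noncomputable def IsCoherent.action (h : IsCoherent (code R) q₀ δ T N Ω) :
    Grp m R →* (Equiv.Perm (Accepted δ q₀))ᵐᵒᵖ :=
  PresentedGroup.toGroup (f := fun i => .op (h.perm i)) <| by
    rintro _ ⟨w, hw, rfl⟩
    refine MulOpposite.unop_injective (Equiv.ext fun f => ?_)
    refine (h.freeAction_mk w f).trans ?_
    refine h.foldl_mul (mem_relators.2 (.inr (.inl ⟨_, List.mem_map_of_mem hw, ?_⟩)))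
      (ofGenWord_valid w) f
    simp [ofGenWord]

theorem IsCoherent.action_gen (h : IsCoherent (code R) q₀ δ T N Ω) {x : Letter}
    (hx : x ∈ letters m) (f : Accepted δ q₀) :
    (h.action (gen R x)).unop f = h.mul x f := by
  rcases x with _ | ⟨i, b⟩
  · simp only [gen, map_one, MulOpposite.unop_one, Equiv.Perm.one_apply]
    exact (h.foldl_mul (r := [none]) (mem_relators.2 (.inl rfl))
      (by simp [none_mem_letters]) f).symm
  · have hi := some_mem_letters.1 hx
    simp only [gen, hi, dite_true]
    exact h.freeAction_mk [(⟨i, hi⟩, b)] f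

/-- By `track_shift`, `x :: u` is a product of `u` by `x`; since products are unique, the action
builds up the word letter by letter from the empty one. -/
theorem IsCoherent.action_val (h : IsCoherent (code R) q₀ δ T N Ω) {w : List Letter} {q : ℕ}
    (hw : Path δ q₀ w q) : (h.action (val R w)).unop (.mk .nil) = .mk hw := by
  induction hw with
  | nil => simp [val]
  | @cons u p p' x hu hd ih =>
    have hx : x ∈ letters m := h.valid _ hd
    rw [val, map_mul, MulOpposite.unop_mul, Equiv.Perm.mul_apply, ih, h.action_gen hx]
    refine h.mul_eq_of_next hx ?_
    have := h.next_of_track (h.track_shift (hu.valid h.valid) hx)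
    rwa [show [none] = List.replicate 1 (none : Letter) from rfl, padded_append] at this

/-- Accepted words of the same length represent different elements. -/
theorem IsCoherent.val_injective (h : IsCoherent (code R) q₀ δ T N Ω) {u v : List Letter}
    {p q : ℕ} (hu : Path δ q₀ u p) (hv : Path δ q₀ v q) (hl : u.length = v.length)
    (he : val R u = val R v) : u = v := by
  have := h.action_val hu
  rw [he, h.action_val hv] at this
  exact padded_injective hl (congrArg Subtype.val this).symm

/-- Loops give exponential growth. -/
theorem IsCoherent.loops_pow_le (h : IsCoherent (code R) q₀ δ T N Ω) {u : List Letter} {q : ℕ}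
    (hu : Path δ q₀ u q) (k j : ℕ) :
    (loops m δ q k).length ^ j ≤ (ball R (u.length + k * j)).ncard := by
  have key : ∀ j, ∃ Z : Finset (List Letter),
      (∀ w ∈ Z, Path δ q₀ w q ∧ w.length = u.length + k * j) ∧
        (loops m δ q k).length ^ j ≤ Z.card := by
    intro j
    induction j with
    | zero => exact ⟨{u}, by simp [hu], by simp⟩
    | succ j ih =>
      obtain ⟨Z, hZ, hc⟩ := ih
      have hnd : (loops m δ q k).Nodup := (nodup_allWords m k).filter _
      refine ⟨Finset.image₂ (fun l w => l ++ w) (loops m δ q k).toFinset Z, ?_, ?_⟩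
      · intro _ hlw
        obtain ⟨l, hl, w, hw, rfl⟩ := Finset.mem_image₂.1 hlw
        obtain ⟨⟨hk, -⟩, hp⟩ := mem_loops.1 (List.mem_toFinset.1 hl)
        refine ⟨(hZ w hw).1.append hp, ?_⟩
        rw [List.length_append, hk, (hZ w hw).2]
        ring
      · rw [Finset.card_image₂_iff.2, List.toFinset_card_of_nodup hnd, pow_succ, mul_comm]
        · exact Nat.mul_le_mul_left _ hc
        -- All loops have the same length `k`, so a concatenation determines both factors.
        · rintro ⟨l, w⟩ hlw ⟨l', w'⟩ hlw' he
          have h1 := (mem_loops.1 (List.mem_toFinset.1 (Set.mem_prod.1 hlw).1)).1.1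
          have h2 := (mem_loops.1 (List.mem_toFinset.1 (Set.mem_prod.1 hlw').1)).1.1
          have := List.append_inj he (h1.trans h2.symm)
          exact Prod.ext this.1 this.2
  obtain ⟨Z, hZ, hc⟩ := key j
  refine hc.trans ?_
  rw [← Set.ncard_coe_finset]
  refine Set.ncard_le_ncard_of_injOn (val R) ?_ ?_ (finite_ball R _)
  · intro w hw
    exact (wordNorm_val_le R w).trans (hZ w hw).2.le
  · intro v hv w hw he
    exact h.val_injective (hZ v hv).1 (hZ w hw).1 ((hZ v hv).2.trans (hZ w hw).2.symm) he

end Action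

/-! ### Derivations certify upper bounds for balls -/

section Derivations

/-- An elementary step of a derivation: the word `s.2.1` is inserted at the position `s.1`, or
deleted there if it occurs. -/
def applyStep (w : List Letter) (s : ℕ × List Letter × Bool) : List Letter :=
  if s.2.2 = true then w.take s.1 ++ s.2.1 ++ w.drop s.1
  else if (w.drop s.1).take s.2.1.length = s.2.1 then
    w.take s.1 ++ w.drop (s.1 + s.2.1.length) else w

/-- The list `E` consists of derivations which show that every element of the ball of radius `L`
is represented by a word from `C`. -/
def IsCover (P : Presentation) (L : ℕ) (C : List (List Letter))
    (E : List (List Letter × List (ℕ × List Letter × Bool))) : Prop :=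
  ∀ w ∈ allWords P.1 L, ∃ e ∈ E, e.1 = w ∧ (∀ s ∈ e.2, s.2.1 ∈ relators P) ∧
    e.2.foldl applyStep e.1 ∈ C

variable {m : ℕ} {R : List (GenWord m)}

theorem fwd_applyStep {s : ℕ × List Letter × Bool} (hs : s.2.1 ∈ relators (code R))
    (w : List Letter) : fwd R (applyStep w s) = fwd R w := by
  unfold applyStep
  split_ifs with h1 h2
  · conv_rhs => rw [← List.take_append_drop s.1 w]
    rw [fwd_append, fwd_append, fwd_append, fwd_relator R hs, mul_one]
  · conv_rhs => rw [← List.take_append_drop s.1 w, ← List.take_append_drop s.2.1.length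
      (w.drop s.1), h2, List.drop_drop]
    rw [fwd_append, fwd_append, fwd_append, fwd_relator R hs, one_mul]
  · rfl

theorem fwd_foldl_applyStep {l : List (ℕ × List Letter × Bool)}
    (hl : ∀ s ∈ l, s.2.1 ∈ relators (code R)) (w : List Letter) :
    fwd R (l.foldl applyStep w) = fwd R w := by
  induction l generalizing w with
  | nil => rfl
  | cons s l ih =>
    rw [List.foldl_cons, ih (fun t ht => hl t (by simp [ht])), fwd_applyStep (hl s (by simp))]

theorem exists_fwd_eq {x : Grp m R} {L : ℕ} (hx : wordNorm R x ≤ L) :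
    ∃ w ∈ allWords m L, fwd R w = x := by
  obtain ⟨w, hl, hv, rfl⟩ := exists_val_eq R hx
  refine ⟨w.reverse, mem_allWords.2 ⟨by simpa using hl, fun a ha => hv a (by simpa using ha)⟩, ?_⟩
  rw [← val_reverse, List.reverse_reverse]

theorem IsCover.ncard_ball_le {L : ℕ} {C : List (List Letter)}
    {E : List (List Letter × List (ℕ × List Letter × Bool))} (h : IsCover (code R) L C E) :
    (ball R L).ncard ≤ C.length := by
  classical
  have hsub : ball R L ⊆ ((C.map (fwd R)).toFinset : Set (Grp m R)) := by
    intro x hx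
    -- Because of padding, words of length exactly `L` suffice for the whole ball.
    obtain ⟨w, hw, rfl⟩ := exists_fwd_eq hx
    obtain ⟨e, -, rfl, hs, hC⟩ := h w hw
    simp only [List.coe_toFinset, List.mem_map]
    exact ⟨_, hC, fwd_foldl_applyStep hs _⟩
  refine (Set.ncard_le_ncard hsub (Finset.finite_toSet _)).trans ?_
  rw [Set.ncard_coe_finset]
  exact (List.toFinset_card_le _).trans (by simp)

/-- Insertion of a relator. -/
def Insertion (P : Presentation) (u v : List Letter) : Prop :=
  ∃ a b r, r ∈ relators P ∧ u = a ++ b ∧ v = a ++ r ++ b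

/-- Derivations in both directions are carried through the induction, which makes the symmetric case
immediate; an insertion is undone by the deletion at the same position. -/
theorem exists_steps {P : Presentation} {u v : List Letter}
    (h : Relation.EqvGen (Insertion P) u v) :
    (∃ l : List (ℕ × List Letter × Bool), (∀ s ∈ l, s.2.1 ∈ relators P) ∧
      l.foldl applyStep u = v) ∧
    ∃ l : List (ℕ × List Letter × Bool), (∀ s ∈ l, s.2.1 ∈ relators P) ∧
      l.foldl applyStep v = u := by
  induction h with
  | rel u v h =>
    obtain ⟨a, b, r, hr, rfl, rfl⟩ := h
    refine ⟨⟨[(a.length, r, true)], by simpa using hr, ?_⟩,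
      ⟨[(a.length, r, false)], by simpa using hr, ?_⟩⟩
    · simp [applyStep]
    · simp [applyStep]
  | refl u => exact ⟨⟨[], by simp, rfl⟩, ⟨[], by simp, rfl⟩⟩
  | symm u v _ ih => exact ih.symm
  | trans u v w _ _ ih1 ih2 =>
    obtain ⟨⟨l1, h1, rfl⟩, ⟨l1', h1', e1⟩⟩ := ih1
    obtain ⟨⟨l2, h2, rfl⟩, ⟨l2', h2', e2⟩⟩ := ih2
    refine ⟨⟨l1 ++ l2, fun s hs => ?_, by simp⟩, ⟨l2' ++ l1', fun s hs => ?_, ?_⟩⟩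
    · exact (List.mem_append.1 hs).elim (h1 s) (h2 s)
    · exact (List.mem_append.1 hs).elim (h2' s) (h1' s)
    · rw [List.foldl_append, e2, e1]

theorem eqvGen_append {P : Presentation} {u v : List Letter}
    (h : Relation.EqvGen (Insertion P) u v) (a b : List Letter) :
    Relation.EqvGen (Insertion P) (a ++ u ++ b) (a ++ v ++ b) := by
  induction h with
  | rel u v h =>
    obtain ⟨c, d, r, hr, rfl, rfl⟩ := h
    exact .rel _ _ ⟨a ++ c, d ++ b, r, hr, by simp, by simp⟩
  | refl u => exact .refl _
  | symm u v _ ih => exact ih.symm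
  | trans u v w _ _ ih1 ih2 => exact ih1.trans _ _ _ ih2

/-- The congruence on words that the relators generate. -/
def relatorCon (P : Presentation) : Con (FreeMonoid Letter) where
  r := Relation.EqvGen (Insertion P)
  iseqv := Relation.EqvGen.is_equivalence _
  mul' {w x y z} h1 h2 := by
    have e1 := eqvGen_append h1 [] y
    have e2 := eqvGen_append h2 x []
    simp only [List.append_nil] at e1 e2
    exact e1.trans _ _ _ e2

/-- The class of a word. -/
def wordClass (P : Presentation) (w : List Letter) : (relatorCon P).Quotient :=
  Con.toQuotient (c := relatorCon P) (FreeMonoid.ofList w)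

theorem wordClass_append (P : Presentation) (u v : List Letter) :
    wordClass P (u ++ v) = wordClass P u * wordClass P v := rfl

theorem wordClass_nil (P : Presentation) : wordClass P [] = 1 := rfl

theorem wordClass_eq {P : Presentation} {u v : List Letter} :
    wordClass P u = wordClass P v ↔ Relation.EqvGen (Insertion P) u v :=
  Con.eq _

theorem wordClass_relator {P : Presentation} {r : List Letter} (hr : r ∈ relators P) :
    wordClass P r = 1 :=
  (wordClass_eq.2 (.rel [] r ⟨[], [], r, hr, rfl, by simp⟩)).symm

/-- The class of a generator, as a unit. -/
def genUnit (R : List (GenWord m)) (i : Fin m) : (relatorCon (code R)).Quotientˣ where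
  val := wordClass _ [some (i, true)]
  inv := wordClass _ [some (i, false)]
  val_inv := by
    rw [← wordClass_append]
    exact wordClass_relator (mem_relators.2 (.inr (.inr ⟨i, i.2, true, rfl⟩)))
  inv_val := by
    rw [← wordClass_append]
    exact wordClass_relator (mem_relators.2 (.inr (.inr ⟨i, i.2, false, rfl⟩)))

theorem lift_genUnit (w : GenWord m) :
    (FreeGroup.lift (genUnit R) (FreeGroup.mk w) : (relatorCon (code R)).Quotient) =
      wordClass _ (ofGenWord w) := by
  induction w with
  | nil => simp [ofGenWord, ← FreeGroup.one_eq_mk, wordClass_nil]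
  | cons a w ih =>
    rw [← List.singleton_append, ← FreeGroup.mul_mk, map_mul, Units.val_mul, ih]
    obtain ⟨i, b⟩ := a
    rw [show ofGenWord ([(i, b)] ++ w) = [some ((i : ℕ), b)] ++ ofGenWord w from rfl,
      wordClass_append]
    congr 1
    cases b
    · simp [FreeGroup.lift_mk]
      rfl
    · simp [FreeGroup.lift_mk]
      rfl

/-- The map from the group to the classes of words. -/
def toWordClass (R : List (GenWord m)) : Grp m R →* (relatorCon (code R)).Quotientˣ :=
  PresentedGroup.toGroup (f := genUnit R) <| by
    rintro _ ⟨w, hw, rfl⟩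
    refine Units.ext ((lift_genUnit w).trans ?_)
    refine wordClass_relator (mem_relators.2 (.inr (.inl ⟨_, List.mem_map_of_mem hw, ?_⟩)))
    simp [ofGenWord]

theorem toWordClass_fwd {w : List Letter} (hw : ∀ x ∈ w, x ∈ letters m) :
    (toWordClass R (fwd R w) : (relatorCon (code R)).Quotient) = wordClass _ w := by
  induction w with
  | nil => simp [fwd_nil, wordClass_nil]
  | cons x w ih =>
    rw [fwd_cons, map_mul, Units.val_mul, ih (fun y hy => hw y (by simp [hy])),
      ← List.singleton_append, wordClass_append]
    congr 1
    rcases x with _ | ⟨i, b⟩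
    · simp only [gen, map_one, Units.val_one]
      exact (wordClass_relator (mem_relators.2 (.inl rfl))).symm
    · have hi : i < m := some_mem_letters.1 (hw (some (i, b)) (by simp))
      simp only [gen, hi, dite_true]
      exact lift_genUnit [(⟨i, hi⟩, b)]

/-- Completeness of derivations: modulo them, words form a monoid in which the generators are units
satisfying the relators. The group therefore maps to the units of this monoid, and equal elements
have equal classes. -/
theorem exists_steps_of_fwd_eq {u v : List Letter} (hu : ∀ x ∈ u, x ∈ letters m)
    (hv : ∀ x ∈ v, x ∈ letters m) (h : fwd R u = fwd R v) :
    ∃ l : List (ℕ × List Letter × Bool), (∀ s ∈ l, s.2.1 ∈ relators (code R)) ∧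
      l.foldl applyStep u = v := by
  refine (exists_steps (wordClass_eq.1 ?_)).1
  rw [← toWordClass_fwd hu, h, toWordClass_fwd hv]

theorem exists_isCover (R : List (GenWord m)) (L : ℕ) :
    ∃ C E, IsCover (code R) L C E ∧ C.length = (ball R L).ncard := by
  choose rep hrep hval using fun x : ball R L => exists_fwd_eq (R := R) x.2
  choose! steps hsteps hfold using fun (w : List Letter) (hw : w ∈ allWords m L) =>
    have hb : fwd R w ∈ ball R L := (wordNorm_fwd_le R w).trans (mem_allWords.1 hw).1.le
    exists_steps_of_fwd_eq (R := R) (mem_allWords.1 hw).2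
      (mem_allWords.1 (hrep ⟨_, hb⟩)).2 (hval ⟨_, hb⟩).symm
  have := (finite_ball R L).fintype
  refine ⟨(Finset.univ : Finset (ball R L)).toList.map rep,
    (allWords m L).map fun w => (w, steps w), ?_, ?_⟩
  · intro w hw
    refine ⟨_, List.mem_map_of_mem hw, rfl, hsteps w hw, ?_⟩
    simp only [List.mem_map, Finset.mem_toList, Finset.mem_univ, true_and]
    exact ⟨_, (hfold w hw).symm⟩
  · rw [List.length_map, Finset.length_toList, Finset.card_univ, ← Nat.card_eq_fintype_card]
    rfl

end Derivations

/-! ### Shortlex words and the fellow traveller property -/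

section LexLeast

variable {m : ℕ}

/-- The position of a letter in a linear order whose least element is the trivial letter. -/
def rank : Letter → ℕ
  | none => 0
  | some (i, b) => 2 * i + b.toNat + 1

theorem rank_injective : Function.Injective rank := by
  rintro (_ | ⟨i, b⟩) (_ | ⟨j, c⟩) h
  · rfl
  · simp [rank] at h
  · simp [rank] at h
  · cases b <;> cases c <;> simp [rank] at h ⊢ <;> omega

theorem rank_lt {x : Letter} (hx : x ∈ letters m) : rank x < 2 * m + 1 := by
  rcases x with _ | ⟨i, b⟩
  · simp [rank]
  · have := some_mem_letters.1 hx
    cases b <;> simp [rank] <;> omega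

/-- The number with the digits of a word: it orders words of equal length lexicographically. -/
def key (m : ℕ) : List Letter → ℕ
  | [] => 0
  -- The letter read first is the most significant digit, and the trivial letter is the digit 0.
  -- Least words therefore carry their padding in front and are shortlex after it.
  | x :: w => (2 * m + 1) * key m w + rank x

theorem key_cons_lt {x y : Letter} {u v : List Letter} (hy : y ∈ letters m)
    (h : key m (x :: u) < key m (y :: v)) :
    key m u < key m v ∨ key m u = key m v ∧ rank x < rank y := by
  have h2 := rank_lt hy
  simp only [key] at h
  rcases lt_trichotomy (key m u) (key m v) with h3 | h3 | h3
  · exact .inl h3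
  · exact .inr ⟨h3, by rw [h3] at h; omega⟩
  · have : (2 * m + 1) * (key m v + 1) ≤ (2 * m + 1) * key m u := Nat.mul_le_mul_left _ h3
    rw [mul_add] at this
    omega

theorem key_injective {u v : List Letter} (hu : ∀ x ∈ u, x ∈ letters m)
    (hv : ∀ x ∈ v, x ∈ letters m) (hl : u.length = v.length) (h : key m u = key m v) : u = v := by
  induction u generalizing v with
  | nil => exact (List.length_eq_zero_iff.1 hl.symm).symm
  | cons x u ih =>
    rcases v with _ | ⟨y, v⟩
    · simp at hl
    · have hx := rank_lt (hu x (by simp))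
      have hy := rank_lt (hv y (by simp))
      simp only [key] at h
      have h1 : rank x = rank y := by
        have := congrArg (· % (2 * m + 1)) h
        simpa [Nat.mul_add_mod, Nat.mod_eq_of_lt hx, Nat.mod_eq_of_lt hy] using this
      have h2 : key m u = key m v := by
        rw [h1] at h
        simpa using h
      rw [rank_injective h1, ih (v := v) (fun a ha => hu a (by simp [ha]))
        (fun a ha => hv a (by simp [ha])) (by simpa using hl) h2]

theorem key_append_replicate (u : List Letter) (n : ℕ) :
    key m (u ++ List.replicate n none) = key m u := by
  induction u with
  | nil =>
    induction n with
    | zero => rfl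
    | succ n ih => simpa [List.replicate_succ, key, rank] using ih
  | cons x u ih => simp [key, ih]

theorem key_lt_pow {u : List Letter} (hu : ∀ x ∈ u, x ∈ letters m) :
    key m u < (2 * m + 1) ^ u.length := by
  induction u with
  | nil => simp [key]
  | cons x u ih =>
    have h1 := rank_lt (hu x (by simp))
    have h2 := ih fun a ha => hu a (by simp [ha])
    have : (2 * m + 1) * (key m u + 1) ≤ (2 * m + 1) * (2 * m + 1) ^ u.length :=
      Nat.mul_le_mul_left _ h2
    rw [List.length_cons, pow_succ', key]
    rw [mul_add] at this
    omega

variable (R : List (GenWord m))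

theorem wordNorm_gen_le (x : Letter) : wordNorm R (gen R x) ≤ 1 := by
  simpa [fwd] using wordNorm_fwd_le R [x]

theorem wordNorm_mul_gen_le (g : Grp m R) (x : Letter) :
    wordNorm R (g * gen R x) ≤ wordNorm R g + 1 :=
  (wordNorm_mul_le R _ _).trans (Nat.add_le_add_left (wordNorm_gen_le R x) _)

theorem wordNorm_le_mul_gen (g : Grp m R) (x : Letter) :
    wordNorm R g ≤ wordNorm R (g * gen R x) + 1 := by
  have := wordNorm_mul_gen_le R (g * gen R x) (Letter.inv x)
  rwa [gen_inv, mul_inv_cancel_right] at this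

/-- Only the `c` least significant digits can be nonzero, so at most `c` letters are nontrivial. -/
theorem wordNorm_val_le_of_key_lt {w : List Letter} {c : ℕ} (h : key m w < (2 * m + 1) ^ c) :
    wordNorm R (val R w) ≤ c := by
  induction w generalizing c with
  | nil => simp [val, wordNorm_one]
  | cons x w ih =>
    rw [key] at h
    rcases c with _ | c
    · rw [pow_zero] at h
      have hr : rank x = rank none := by
        rw [show rank none = 0 from rfl]
        omega
      have hk : key m w < (2 * m + 1) ^ 0 := by
        have : (2 * m + 1) * key m w = 0 := by omega
        simpa using this
      rw [rank_injective hr]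
      simpa [val, gen] using ih hk
    · refine (wordNorm_mul_gen_le R _ _).trans (Nat.add_le_add_right (ih ?_) 1)
      rw [pow_succ'] at h
      exact lt_of_mul_lt_mul_left (lt_of_le_of_lt (Nat.le_add_right _ _) h) (Nat.zero_le _)

/-- The word is lexicographically least among the words of the same length that represent the same
element. -/
def IsLexLeast (w : List Letter) : Prop :=
  (∀ x ∈ w, x ∈ letters m) ∧ ∀ v : List Letter, (∀ x ∈ v, x ∈ letters m) →
    v.length = w.length → val R v = val R w → key m w ≤ key m v

variable {R}

theorem IsLexLeast.eq {u v : List Letter} (hu : IsLexLeast R u) (hv : IsLexLeast R v)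
    (hl : u.length = v.length) (h : val R u = val R v) : u = v :=
  key_injective hu.1 hv.1 hl ((hu.2 v hv.1 hl.symm h.symm).antisymm (hv.2 u hu.1 hl h))

theorem exists_isLexLeast {x : Grp m R} {n : ℕ} (h : wordNorm R x ≤ n) :
    ∃ w, IsLexLeast R w ∧ w.length = n ∧ val R w = x := by
  obtain ⟨w, hw, hmin⟩ := (measure (key m)).wf.has_min
    {w : List Letter | w.length = n ∧ (∀ a ∈ w, a ∈ letters m) ∧ val R w = x}
    (exists_val_eq R h)
  refine ⟨w, ⟨hw.2.1, fun v hv hl he => not_lt.1 (hmin v ⟨hl.trans hw.1, hv, he.trans hw.2.2⟩)⟩,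
    hw.1, hw.2.2⟩

theorem IsLexLeast.tail {x : Letter} {u : List Letter} (h : IsLexLeast R (x :: u)) :
    IsLexLeast R u := by
  refine ⟨fun a ha => h.1 a (by simp [ha]), fun v hv hl he => ?_⟩
  have := h.2 (x :: v) (List.forall_mem_cons.2 ⟨h.1 x (by simp), hv⟩) (by simp [hl])
    (by simp [val, he])
  simp only [key] at this
  exact Nat.le_of_mul_le_mul_left (Nat.le_of_add_le_add_right this) (by omega)

/-- Least words are padded geodesics. If the norm did not drop, comparison with a padded geodesic of
length `a` would give `key m (x :: u) < (2 * m + 1) ^ a`; dividing by the base leaves `u` with at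
most `b - 1` nontrivial letters, contradicting its norm `b`. Truncated subtraction covers the
trivial element. -/
theorem IsLexLeast.wordNorm_tail {x : Letter} {u : List Letter} (h : IsLexLeast R (x :: u)) :
    wordNorm R (val R u) = wordNorm R (val R (x :: u)) - 1 := by
  have h1 : wordNorm R (val R (x :: u)) ≤ wordNorm R (val R u) + 1 := wordNorm_mul_gen_le R _ x
  refine le_antisymm ?_ (by omega)
  by_contra! hlt
  set a := wordNorm R (val R (x :: u)) with ha
  set b := wordNorm R (val R u) with hb
  have hbu : b ≤ u.length := wordNorm_val_le R u
  have hab : a ≤ b := by omega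
  obtain ⟨p, hp, hpv, hpe⟩ := exists_val_eq R ha.ge
  have hle := h.2 (p ++ List.replicate (u.length + 1 - a) none) (by
      intro y hy
      rcases List.mem_append.1 hy with hy | hy
      · exact hpv y hy
      · rw [List.eq_of_mem_replicate hy]; exact none_mem_letters m)
    (by simp [hp]; omega) (by
      have : ∀ k, val R (List.replicate k none) = 1 := fun k => by
        induction k with
        | zero => rfl
        | succ k ih => simp [List.replicate_succ, val, ih, gen]
      rw [val_append, this, one_mul, hpe])
  rw [key_append_replicate] at hle
  have h2 : key m (x :: u) < (2 * m + 1) ^ a := hp ▸ lt_of_le_of_lt hle (key_lt_pow hpv)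
  have h3 : key m u < (2 * m + 1) ^ (b - 1) := by
    rcases Nat.eq_zero_or_pos b with h0 | h0
    · omega
    · have h4 : key m (x :: u) < (2 * m + 1) ^ b :=
        h2.trans_le (Nat.pow_le_pow_right (by omega) hab)
      rw [← Nat.sub_add_cancel h0, pow_succ', key] at h4
      exact lt_of_mul_lt_mul_left (lt_of_le_of_lt (Nat.le_add_right _ _) h4) (Nat.zero_le _)
  have h5 : b ≤ b - 1 := wordNorm_val_le_of_key_lt R h3
  omega

theorem IsLexLeast.wordNorm_drop {w : List Letter} (h : IsLexLeast R w) (j : ℕ) :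
    wordNorm R (val R (w.drop j)) = wordNorm R (val R w) - j := by
  induction j generalizing w with
  | zero => simp
  | succ j ih =>
    rcases w with _ | ⟨x, w⟩
    · simp [val, wordNorm_one]
    · rw [List.drop_succ_cons, ih h.tail, h.wordNorm_tail]
      omega

theorem wordNorm_drop_inv_mul_le (w : List Letter) (j : ℕ) :
    wordNorm R ((val R (w.drop j))⁻¹ * val R w) ≤ j := by
  have : val R w = val R (w.drop j) * val R (w.take j) := by
    rw [← val_append, List.take_append_drop]
  rw [this, inv_mul_cancel_left]
  exact (wordNorm_val_le R _).trans (by simp)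

theorem gromovProduct_comm (x y : Grp m R) : gromovProduct R x y = gromovProduct R y x := by
  unfold gromovProduct
  rw [← wordNorm_inv R (x⁻¹ * y), mul_inv_rev, inv_inv]
  ring

/-- A prefix lies on the geodesic: its norm and its distance to the end add up to at most the norm
of the end. Once `j` exceeds that norm, the prefix is trivial. -/
theorem IsLexLeast.le_gromovProduct {w : List Letter} (h : IsLexLeast R w) (j : ℕ) :
    (wordNorm R (val R (w.drop j)) : ℝ) ≤ gromovProduct R (val R (w.drop j)) (val R w) := by
  have h1 := h.wordNorm_drop j
  have h2 : wordNorm R ((val R (w.drop j))⁻¹ * val R w) + wordNorm R (val R (w.drop j)) ≤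
      wordNorm R (val R w) := by
    by_cases hj : j ≤ wordNorm R (val R w)
    · have := wordNorm_drop_inv_mul_le (R := R) w j
      omega
    · have h0 : wordNorm R (val R (w.drop j)) = 0 := by omega
      obtain ⟨v, hv, hl⟩ := exists_word R (val R (w.drop j))
      have : v = [] := List.length_eq_zero_iff.1 (hl.trans h0)
      rw [h0, ← hv, this, value_nil, inv_one, one_mul]
      omega
  have h3 : (wordNorm R ((val R (w.drop j))⁻¹ * val R w) : ℝ) + wordNorm R (val R (w.drop j)) ≤
      wordNorm R (val R w) := by exact_mod_cast h2
  unfold gromovProduct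
  linarith

variable (R) in
/-- Lexicographically least words that represent adjacent elements stay close to each other. -/
def FellowTravel (K : ℕ) : Prop :=
  ∀ (u v : List Letter) (x : Letter), IsLexLeast R u → IsLexLeast R v → x ∈ letters m →
    v.length = u.length + 1 → val R v = val R u * gen R x →
      -- The `+ 1` leaves room for the one extra letter that appears when `v` is aligned with `u ++
      -- [none]`.
      ∀ j, wordNorm R ((val R (u.drop j))⁻¹ * val R (v.drop (j + 1))) + 1 ≤ K

theorem IsHyperbolic.fellowTravel (h : IsHyperbolic R) : ∃ K, FellowTravel R K := by
  obtain ⟨δ, hδ⟩ := h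
  have hδ0 : 0 ≤ δ := by
    have := hδ 1 1 1
    rw [min_self] at this
    linarith
  -- Two applications of hyperbolicity bound the Gromov product of the prefixes below by the least
  -- of `a'`, `b'` and the product of the end points, minus `2 * δ`. Each case gives distance at
  -- most `4 * δ + 2`.
  refine ⟨⌈4 * δ⌉₊ + 4, fun u v x hu hv _ _ he j => ?_⟩
  have hu1 := hu.le_gromovProduct j
  have hv1 := hv.le_gromovProduct (j + 1)
  have hu2 := hu.wordNorm_drop j
  have hv2 := hv.wordNorm_drop (j + 1)
  have hd1 := wordNorm_mul_gen_le R (val R u) x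
  have hd2 := wordNorm_le_mul_gen R (val R u) x
  rw [← he] at hd1 hd2
  have hd : wordNorm R ((val R u)⁻¹ * val R v) ≤ 1 := by
    rw [he, inv_mul_cancel_left]
    exact wordNorm_gen_le R x
  rw [gromovProduct_comm] at hv1
  have h1 := hδ (val R (u.drop j)) (val R u) (val R (v.drop (j + 1)))
  have h2 := hδ (val R u) (val R v) (val R (v.drop (j + 1)))
  have h3 : gromovProduct R (val R u) (val R v) = ((wordNorm R (val R u) : ℝ) +
    wordNorm R (val R v) - wordNorm R ((val R u)⁻¹ * val R v)) / 2 := rfl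
  have h4 : gromovProduct R (val R (u.drop j)) (val R (v.drop (j + 1))) =
    ((wordNorm R (val R (u.drop j)) : ℝ) + wordNorm R (val R (v.drop (j + 1))) -
      wordNorm R ((val R (u.drop j))⁻¹ * val R (v.drop (j + 1)))) / 2 := rfl
  set a := wordNorm R (val R u)
  set b := wordNorm R (val R v)
  set a' := wordNorm R (val R (u.drop j))
  set b' := wordNorm R (val R (v.drop (j + 1)))
  set d := wordNorm R ((val R (u.drop j))⁻¹ * val R (v.drop (j + 1)))
  have hab : a' ≤ b' + 2 ∧ b' ≤ a' + 2 ∧ a' ≤ a ∧ b' ≤ b := by omega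
  obtain ⟨q1, q2, q3, q4⟩ := hab
  have q1' : (a' : ℝ) ≤ b' + 2 := by exact_mod_cast q1
  have q2' : (b' : ℝ) ≤ a' + 2 := by exact_mod_cast q2
  have q3' : (a' : ℝ) ≤ a := by exact_mod_cast q3
  have q4' : (b' : ℝ) ≤ b := by exact_mod_cast q4
  have hd' : (wordNorm R ((val R u)⁻¹ * val R v) : ℝ) ≤ 1 := by exact_mod_cast hd
  have hceil := Nat.le_ceil (4 * δ)
  suffices (d : ℝ) + 1 ≤ (⌈4 * δ⌉₊ : ℝ) + 4 by exact_mod_cast this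
  rcases min_choice (gromovProduct R (val R (u.drop j)) (val R u))
    (gromovProduct R (val R u) (val R (v.drop (j + 1)))) with e1 | e1 <;>
  rcases min_choice (gromovProduct R (val R u) (val R v))
    (gromovProduct R (val R v) (val R (v.drop (j + 1)))) with e2 | e2 <;>
  rw [e1] at h1 <;> rw [e2] at h2 <;> linarith

end LexLeast

/-! ### The automatic structure of a hyperbolic group -/

section TrueAutomaton

open Classical

variable {m : ℕ} (R : List (GenWord m)) (K : ℕ)

/-- The labels: words of length at most `K`. -/
noncomputable def labels (m K : ℕ) : Finset (List Letter) :=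
  ((List.range (K + 1)).flatMap (allWords m)).toFinset

theorem mem_labels {l : List Letter} :
    l ∈ labels m K ↔ l.length ≤ K ∧ ∀ x ∈ l, x ∈ letters m := by
  simp only [labels, List.mem_toFinset, List.mem_flatMap, List.mem_range, mem_allWords]
  constructor
  · rintro ⟨n, hn, rfl, h⟩
    exact ⟨by omega, h⟩
  · rintro ⟨h1, h2⟩
    exact ⟨_, by omega, rfl, h2⟩

theorem exists_label {x : Grp m R} (h : wordNorm R x ≤ K) : ∃ l ∈ labels m K, val R l = x := by
  obtain ⟨l, hl, hv, he⟩ := exists_val_eq R h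
  exact ⟨l, (mem_labels K).2 ⟨hl.le, hv⟩, he⟩

/-- The differences between words that track each other, with their transitions. -/
noncomputable def differenceTracks : Tracks :=
  ((labels m K ×ˢ (letters m).toFinset ×ˢ (letters m).toFinset ×ˢ labels m K).filter fun s =>
    val R s.2.2.2 = (gen R s.2.1)⁻¹ * val R s.1 * gen R s.2.2.1).toList

theorem mem_differenceTracks {l l' : List Letter} {x y : Letter} :
    (l, x, y, l') ∈ differenceTracks R K ↔ (l ∈ labels m K ∧ x ∈ letters m ∧ y ∈ letters m ∧
      l' ∈ labels m K) ∧ val R l' = (gen R x)⁻¹ * val R l * gen R y := by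
  simp [differenceTracks]

/-- The transition function on the sets of differences to smaller words. -/
noncomputable def nextState (S : Finset (List Letter)) (x : Letter) : Finset (List Letter) :=
  (labels m K).filter fun l' => ∃ y ∈ letters m,
    -- A smaller word either was smaller before this letter, or agreed so far and has a smaller
    -- letter here.
    (∃ l ∈ S, val R l' = (gen R x)⁻¹ * val R l * gen R y) ∨
      (rank y < rank x ∧ val R l' = (gen R x)⁻¹ * gen R y)

/-- The differences to smaller words that track the given word. -/
noncomputable def state : List Letter → Finset (List Letter)
  | [] => ∅
  | x :: w => nextState R K (state w) x

/-- The automaton that accepts the lexicographically least words. -/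
noncomputable def leastMoves : Moves :=
  (((labels m K).powerset ×ˢ (letters m).toFinset).filter fun s =>
    -- A trivial difference would mean that a smaller word represents the same element.
    ∀ l ∈ nextState R K s.1 s.2, val R l ≠ 1).toList.map fun s =>
      (Encodable.encode s.1, s.2, Encodable.encode (nextState R K s.1 s.2))

theorem mem_leastMoves {d : ℕ × Letter × ℕ} : d ∈ leastMoves R K ↔ ∃ S x,
    (S ⊆ labels m K ∧ x ∈ letters m) ∧ (∀ l ∈ nextState R K S x, val R l ≠ 1) ∧
      d = (Encodable.encode S, x, Encodable.encode (nextState R K S x)) := by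
  simp only [leastMoves, List.mem_map, Finset.mem_toList, Finset.mem_filter, Finset.mem_product,
    Finset.mem_powerset, List.mem_toFinset, Prod.exists]
  exact exists₂_congr fun S x => by tauto

theorem state_subset (w : List Letter) : state R K w ⊆ labels m K := by
  cases w with
  | nil => simp [state]
  | cons x w => exact Finset.filter_subset _ _

/-- Soundness of the states: each recorded difference can be traced back, letter by letter, to an
actual smaller word. -/
theorem exists_lt_of_mem_state {l w : List Letter} (hw : ∀ x ∈ w, x ∈ letters m)
    (hl : l ∈ state R K w) : ∃ v : List Letter, (∀ x ∈ v, x ∈ letters m) ∧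
      v.length = w.length ∧ key m v < key m w ∧ val R v = val R w * val R l := by
  induction w generalizing l with
  | nil => simp [state] at hl
  | cons x w ih =>
    have hw' : ∀ a ∈ w, a ∈ letters m := fun a ha => hw a (by simp [ha])
    obtain ⟨-, y, hy, ⟨l', hl', he⟩ | ⟨hr, he⟩⟩ := Finset.mem_filter.1 hl
    · obtain ⟨v, hv, hlen, hk, hval⟩ := ih hw' hl'
      refine ⟨y :: v, List.forall_mem_cons.2 ⟨hy, hv⟩, by simp [hlen], ?_, ?_⟩
      · have h1 := rank_lt hy
        have : (2 * m + 1) * (key m v + 1) ≤ (2 * m + 1) * key m w := Nat.mul_le_mul_left _ hk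
        rw [mul_add] at this
        simp only [key]
        omega
      · simp only [val, he, hval]
        group
    · refine ⟨y :: w, List.forall_mem_cons.2 ⟨hy, hw'⟩, by simp, ?_, ?_⟩
      · simp only [key]
        omega
      · simp only [val, he]
        group

/-- Completeness of the states for smaller words that stay within distance `K`, since then all
intermediate differences have labels. -/
theorem mem_state {l v w : List Letter} (hw : ∀ x ∈ w, x ∈ letters m)
    (hv : ∀ x ∈ v, x ∈ letters m) (hlen : v.length = w.length) (hk : key m v < key m w)
    (ht : ∀ j, wordNorm R ((val R (w.drop j))⁻¹ * val R (v.drop j)) ≤ K)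
    (hl : l ∈ labels m K) (he : val R l = (val R w)⁻¹ * val R v) : l ∈ state R K w := by
  induction w generalizing v l with
  | nil =>
    have : v = [] := List.length_eq_zero_iff.1 hlen
    simp [this, key] at hk
  | cons x w ih =>
    rcases v with _ | ⟨y, v⟩
    · simp at hlen
    have hy := hv y (by simp)
    have hw' : ∀ a ∈ w, a ∈ letters m := fun a ha => hw a (by simp [ha])
    have hv' : ∀ a ∈ v, a ∈ letters m := fun a ha => hv a (by simp [ha])
    have hlen' : v.length = w.length := by simpa using hlen
    refine Finset.mem_filter.2 ⟨hl, y, hy, ?_⟩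
    rcases key_cons_lt (hw x (by simp)) hk with h | ⟨h, hr⟩
    · left
      obtain ⟨l', hl', he'⟩ := exists_label R K (ht 1)
      refine ⟨l', ih hw' hv' hlen' h (fun j => by simpa using ht (j + 1)) hl'
        (by simpa using he'), ?_⟩
      rw [he, he']
      simp only [val, List.drop_succ_cons, List.drop_zero]
      group
    · right
      refine ⟨hr, ?_⟩
      rw [he, key_injective hv' hw' hlen' h]
      simp only [val]
      group

variable {R K}

theorem FellowTravel.track_le (h : FellowTravel R K) {u v : List Letter} {x : Letter}
    (hu : IsLexLeast R u) (hv : IsLexLeast R v) (hx : x ∈ letters m)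
    (hl : v.length = u.length + 1) (he : val R v = val R u * gen R x) (j : ℕ) :
    wordNorm R ((val R ((u ++ [none]).drop j))⁻¹ * val R (v.drop j)) ≤ K := by
  have hK : 1 ≤ K := (Nat.le_add_left _ _).trans (h u v x hu hv hx hl he 0)
  by_cases hj : j < v.length
  · have h1 := h u v x hu hv hx hl he j
    have h2 : val R ((u ++ [none]).drop j) = val R (u.drop j) := by
      rw [List.drop_append_of_le_length (by omega), val_append]
      simp [val, gen]
    rw [h2, List.drop_eq_getElem_cons hj, val, ← mul_assoc]
    exact (wordNorm_mul_gen_le R _ _).trans h1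
  · rw [List.drop_eq_nil_of_le (by simp; omega), List.drop_eq_nil_of_le (by omega)]
    simp [val, wordNorm_one]

theorem wordNorm_val_mul_gen_le (u : List Letter) (x : Letter) :
    wordNorm R (val R u * gen R x) ≤ u.length + 1 :=
  (wordNorm_mul_gen_le R _ x).trans
    (Nat.add_le_add_right (wordNorm_val_le R u) 1)

theorem IsLexLeast.path {w : List Letter} (hw : IsLexLeast R w) :
    Path (leastMoves R K) (Encodable.encode (∅ : Finset (List Letter))) w
      (Encodable.encode (state R K w)) := by
  induction w with
  | nil => exact .nil
  | cons x w ih =>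
    refine (ih hw.tail).cons ((mem_leastMoves R K).2
      ⟨state R K w, x, ⟨state_subset R K w, hw.1 x (by simp)⟩, fun l hl h1 => ?_, rfl⟩)
    obtain ⟨v, hv, hlen, hk, he⟩ := exists_lt_of_mem_state R K hw.1 hl
    rw [h1, mul_one] at he
    exact absurd (hw.2 v hv hlen he) (not_le.2 hk)

/-- Competitors within distance `K` suffice: the least word for the value of `x :: u` fellow travels
with the least word `u`. If it were smaller than `x :: u`, the trivial difference `[]` would occur
in the state, and the transition would be forbidden. -/
theorem FellowTravel.path_iff (h : FellowTravel R K) {w : List Letter} {q : ℕ} :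
    Path (leastMoves R K) (Encodable.encode (∅ : Finset (List Letter))) w q ↔
      IsLexLeast R w ∧ q = Encodable.encode (state R K w) := by
  refine ⟨fun hp => ?_, fun ⟨hw, hq⟩ => hq ▸ hw.path⟩
  induction hp with
  | nil =>
    refine ⟨⟨by simp, fun v _ hl _ => ?_⟩, rfl⟩
    rw [List.length_eq_zero_iff.1 hl]
  | @cons u p p' x _ hd ih =>
    obtain ⟨hu, rfl⟩ := ih
    obtain ⟨S, y, ⟨-, hx⟩, hS, he⟩ := (mem_leastMoves R K).1 hd
    simp only [Prod.mk.injEq, Encodable.encode_inj] at he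
    obtain ⟨rfl, rfl, rfl⟩ := he
    refine ⟨?_, rfl⟩
    have hval : ∀ a ∈ x :: u, a ∈ letters m := List.forall_mem_cons.2 ⟨hx, hu.1⟩
    obtain ⟨v, hv, hl, he⟩ := exists_isLexLeast (R := R) (wordNorm_val_mul_gen_le u x)
    refine ⟨hval, fun v' hv' hl' he' => ?_⟩
    refine le_trans ?_ (hv.2 v' hv' (hl'.trans hl.symm) (he'.trans he.symm))
    by_contra! hlt
    have hmem : ([] : List Letter) ∈ state R K (x :: u) := by
      refine mem_state R K hval hv.1 hl hlt (fun j => ?_) ((mem_labels K).2 (by simp)) ?_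
      · rcases j with _ | j
        · simp [val, he, wordNorm_one]
        · exact (Nat.le_succ _).trans (h u v x hu hv hx hl he j)
      · simp [val, he]
    exact hS _ hmem rfl

theorem val_eq_of_track {u l v : List Letter} (h : Track (differenceTracks R K) u l v) :
    val R v = val R u * val R l := by
  induction h with
  | nil => simp [val, gen]
  | cons _ ht ih =>
    have := ((mem_differenceTracks R K).1 ht).2
    simp only [val, ih, this]
    group

theorem label_of_track (hK : 1 ≤ K) {u l v : List Letter}
    (h : Track (differenceTracks R K) u l v) : l ∈ labels m K := by
  cases h with
  | nil => exact (mem_labels K).2 ⟨hK, by simp [none_mem_letters]⟩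
  | cons _ ht => exact ((mem_differenceTracks R K).1 ht).1.2.2.2

/-- Labels need not be unique for an element. Intermediate ones are chosen arbitrarily and only the
last is prescribed, which requires `u ≠ []` because the initial state is fixed to be `[none]`. -/
theorem exists_track (hK : 1 ≤ K) {u v : List Letter} (hu : ∀ x ∈ u, x ∈ letters m)
    (hv : ∀ x ∈ v, x ∈ letters m) (hl : u.length = v.length)
    (ht : ∀ j, wordNorm R ((val R (u.drop j))⁻¹ * val R (v.drop j)) ≤ K) :
    ∃ l, Track (differenceTracks R K) u l v ∧ ∀ l' ∈ labels m K, u ≠ [] →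
      val R l' = (val R u)⁻¹ * val R v → Track (differenceTracks R K) u l' v := by
  induction u generalizing v with
  | nil =>
    rw [List.length_eq_zero_iff.1 hl.symm]
    exact ⟨_, .nil, by simp⟩
  | cons x u ih =>
    rcases v with _ | ⟨y, v⟩
    · simp at hl
    obtain ⟨l, h, -⟩ := ih (v := v) (fun a ha => hu a (by simp [ha]))
      (fun a ha => hv a (by simp [ha])) (by simpa using hl)
      (fun j => by simpa using ht (j + 1))
    have key : ∀ l' ∈ labels m K, val R l' = (val R (x :: u))⁻¹ * val R (y :: v) →
        Track (differenceTracks R K) (x :: u) l' (y :: v) := fun l' hl' he => by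
      refine h.cons ((mem_differenceTracks R K).2
        ⟨⟨label_of_track hK h, hu x (by simp), hv y (by simp), hl'⟩, ?_⟩)
      have := val_eq_of_track h
      rw [he]
      simp only [val, this]
      group
    obtain ⟨l', hl', he⟩ := exists_label R K (ht 0)
    exact ⟨l', key l' hl' he, fun l' hl' _ => key l' hl'⟩

theorem FellowTravel.exists_track (h : FellowTravel R K) (hK : 1 ≤ K) {u : List Letter}
    {x : Letter} (hu : IsLexLeast R u) (hx : x ∈ letters m) :
    ∃ v, IsLexLeast R v ∧ Track (differenceTracks R K) (u ++ [none]) [x] v := by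
  obtain ⟨v, hv, hl, he⟩ := exists_isLexLeast (R := R) (wordNorm_val_mul_gen_le u x)
  refine ⟨v, hv, ?_⟩
  obtain ⟨l, -, ht⟩ := FinitePresentation.exists_track (R := R) hK (u := u ++ [none]) (v := v)
    (by
      intro a ha
      rcases List.mem_append.1 ha with ha | ha
      · exact hu.1 a ha
      · rw [List.mem_singleton.1 ha]; exact none_mem_letters m) hv.1 (by simp [hl])
    (h.track_le hu hv hx hl he)
  refine ht _ ((mem_labels K).2 ⟨hK, by simpa using hx⟩) (by simp) ?_
  rw [he, val_append]
  simp [val, gen]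

theorem val_eq_of_chain {q₀ : ℕ} {δ : Moves} {r u v : List Letter} {t : Claims}
    (h : Chain δ (differenceTracks R K) q₀ u t v)
    (ht : t.map Prod.fst = r.map (fun a => [a])) : val R v = val R u * fwd R r := by
  induction t generalizing r u with
  | nil =>
    have : r = [] := by simpa using ht.symm
    rw [this, fwd_nil, mul_one, show u = v from h]
  | cons c t ih =>
    obtain ⟨l, q⟩ := c
    rcases r with _ | ⟨a, r⟩
    · simp at ht
    obtain ⟨u', -, htr, hc⟩ := h
    simp only [List.map_cons, List.cons.injEq] at ht
    rw [ih hc ht.2, val_eq_of_track htr, ht.1, fwd_cons, mul_assoc]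
    simp [val]

theorem Chain.exists_path {q₀ q : ℕ} {δ : Moves} {T : Tracks} {u v : List Letter} {t : Claims}
    (h : Chain δ T q₀ u t v) (hu : Path δ q₀ u q) : ∃ p, Path δ q₀ v p := by
  induction t generalizing u q with
  | nil => exact ⟨q, (show u = v from h) ▸ hu⟩
  | cons c t ih =>
    obtain ⟨u', hp, -, hc⟩ := h
    exact ih hc hp

theorem Chain.length_eq {q₀ : ℕ} {δ : Moves} {T : Tracks} {u v : List Letter} {t : Claims}
    (h : Chain δ T q₀ u t v) : u.length = v.length := by
  induction t generalizing u with
  | nil => rw [show u = v from h]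
  | cons c t ih =>
    obtain ⟨u', -, ht, hc⟩ := h
    exact ht.length_eq.trans (ih hc)

/-- The codes of the states. -/
noncomputable def stateCodes (m K : ℕ) : Finset ℕ := (labels m K).powerset.image Encodable.encode

theorem FellowTravel.mem_stateCodes (h : FellowTravel R K) {w : List Letter} {q : ℕ}
    (hp : Path (leastMoves R K) (Encodable.encode (∅ : Finset (List Letter))) w q) :
    q ∈ stateCodes m K := by
  rw [(h.path_iff.1 hp).2]
  exact Finset.mem_image_of_mem _ (Finset.mem_powerset.2 (state_subset R K w))

theorem Chain.mem_of_mem {q₀ : ℕ} {u v : List Letter} {t : Claims} {δ : Moves} {T : Tracks}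
    {A : Finset (List Letter)} {B : Finset ℕ} (hA : ∀ u l v, Track T u l v → l ∈ A)
    (hB : ∀ u q, Path δ q₀ u q → q ∈ B) (h : Chain δ T q₀ u t v) :
    ∀ c ∈ t, c ∈ A ×ˢ B := by
  induction t generalizing u with
  | nil => simp
  | cons c t ih =>
    obtain ⟨u', hp, ht, hc⟩ := h
    exact List.forall_mem_cons.2 ⟨Finset.mem_product.2 ⟨hA _ _ _ ht, hB _ _ hp⟩, ih hc⟩

theorem finite_lists {α : Type*} (F : Finset α) (n : ℕ) :
    {l : List α | l.length ≤ n ∧ ∀ a ∈ l, a ∈ F}.Finite := by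
  refine ((List.finite_length_le F n).image (List.map Subtype.val)).subset ?_
  rintro l ⟨hl, hF⟩
  refine ⟨l.pmap (fun a ha => ⟨a, ha⟩) hF, by simpa using hl, ?_⟩
  rw [List.map_pmap]
  simp

variable (R K) in
/-- All true claims about the words that track a given word. -/
noncomputable def trueClaims (w : List Letter) : Finset (List Letter × ℕ) :=
  (labels m K ×ˢ stateCodes m K).filter fun c => ∃ v,
    Path (leastMoves R K) (Encodable.encode (∅ : Finset (List Letter))) v c.2 ∧
      Track (differenceTracks R K) (w ++ [none]) c.1 v

/-- `N` consists of the complete lists of true claims and `Ω` of the chains that actually occur, so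
the step conditions amount to removing or adding letters of actual words. `closed` holds because a
chain along a relator joins least words of equal length and equal value. -/
theorem FellowTravel.exists_isCoherent (h : FellowTravel R K) (hK : 1 ≤ K) :
    ∃ N Ω, IsCoherent (code R) (Encodable.encode (∅ : Finset (List Letter))) (leastMoves R K)
      (differenceTracks R K) N Ω := by
  set q₀ := Encodable.encode (∅ : Finset (List Letter)) with hq₀
  set δ := leastMoves R K with hδ
  set T := differenceTracks R K with hT
  have hvalid : ∀ d ∈ δ, d.2.1 ∈ letters m := by
    intro d hd
    obtain ⟨S, x, ⟨-, hx⟩, -, rfl⟩ := (mem_leastMoves R K).1 hd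
    exact hx
  have hlab : ∀ u l v, Track T u l v → l ∈ labels m K := fun u l v ht => label_of_track hK ht
  have hcode : ∀ u q, Path δ q₀ u q → q ∈ stateCodes m K := fun u q hp => h.mem_stateCodes hp
  have hNfin : {c : ℕ × Claims | ∃ w,
      Path δ q₀ w c.1 ∧ c.2 = (trueClaims R K w).toList}.Finite := by
    refine ((stateCodes m K ×ˢ (labels m K ×ˢ stateCodes m K).powerset).finite_toSet.image
      fun c => (c.1, c.2.toList)).subset ?_
    rintro ⟨q, C⟩ ⟨w, hw, rfl⟩
    exact ⟨(q, trueClaims R K w), by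
      simp only [Finset.mem_coe, Finset.mem_product, Finset.mem_powerset]
      exact ⟨hcode _ _ hw, Finset.filter_subset _ _⟩, rfl⟩
  -- The sum of the relator lengths is merely a common bound that keeps the set finite; `lifts`
  -- preserves the length of a chain.
  have hΩfin : {o : ℕ × Claims × Bool |
      o.2.1.length ≤ ((relators (code R)).map List.length).sum ∧
      ∃ u v, Path δ q₀ u o.1 ∧ Chain δ T q₀ u o.2.1 v ∧ o.2.2 = decide (u = v)}.Finite := by
    refine ((stateCodes m K).finite_toSet.prod ((finite_lists (labels m K ×ˢ stateCodes m K)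
      ((relators (code R)).map List.length).sum).prod (Set.finite_univ (α := Bool)))).subset ?_
    rintro ⟨q, t, b⟩ ⟨hl, u, v, hu, hc, -⟩
    exact ⟨hcode _ _ hu, ⟨hl, hc.mem_of_mem hlab hcode⟩, trivial⟩
  have hsum : ∀ r ∈ relators (code R), r.length ≤ ((relators (code R)).map List.length).sum :=
    fun r hr => List.single_le_sum (by simp) _ (List.mem_map_of_mem hr)
  have memN : ∀ c, c ∈ hNfin.toFinset.toList ↔
      ∃ w, Path δ q₀ w c.1 ∧ c.2 = (trueClaims R K w).toList := by simp
  have memΩ : ∀ o, o ∈ hΩfin.toFinset.toList ↔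
      o.2.1.length ≤ ((relators (code R)).map List.length).sum ∧
      ∃ u v, Path δ q₀ u o.1 ∧ Chain δ T q₀ u o.2.1 v ∧ o.2.2 = decide (u = v) := by simp
  have hnil : ∀ r : List Letter, Chain δ T q₀ [] (r.map fun _ => ([none], q₀)) [] := by
    intro r
    induction r with
    | nil => rfl
    | cons a r ih => exact ⟨[], .nil, .nil, ih⟩
  refine ⟨hNfin.toFinset.toList, hΩfin.toFinset.toList, ?_, hvalid, ?_, ?_, ?_, ?_, ?_, ?_, ?_⟩
  · refine (mem_leastMoves R K).2 ⟨∅, none, ⟨by simp, none_mem_letters m⟩, ?_, ?_⟩ <;>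
    · have : nextState R K ∅ none = ∅ := by simp [nextState, rank]
      simp [this, hq₀]
  · intro x (hx : x ∈ letters m) y (hy : y ∈ letters m)
    refine (mem_differenceTracks R K).2 ⟨⟨(mem_labels K).2 ⟨hK, by simpa using hx⟩, hx, hy,
      (mem_labels K).2 ⟨hK, by simpa using hy⟩⟩, ?_⟩
    simp [val]
  · refine ⟨(q₀, (trueClaims R K []).toList), (memN _).2 ⟨[], .nil, rfl⟩, rfl, ?_⟩
    rintro ⟨l, p⟩ hc
    obtain ⟨-, v, hv, ht⟩ := Finset.mem_filter.1 (Finset.mem_toList.1 hc)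
    cases ht with
    | cons ht hT' =>
      cases ht
      cases hv with
      | cons hv hd =>
        cases hv
        exact ⟨_, List.mem_singleton_self _, _, hvalid _ hd, hT', hd⟩
  · rintro ⟨q, C⟩ hc ⟨q', x, p⟩ hd rfl
    obtain ⟨w, hw, rfl⟩ := (memN _).1 hc
    refine ⟨(p, (trueClaims R K (x :: w)).toList), (memN _).2 ⟨x :: w, hw.cons hd, rfl⟩, rfl, ?_⟩
    rintro ⟨l', s'⟩ hc
    obtain ⟨-, v, hv, ht⟩ := Finset.mem_filter.1 (Finset.mem_toList.1 hc)
    cases ht with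
    | cons ht hT' =>
      cases hv with
      | cons hv hd' =>
        exact ⟨(_, _), Finset.mem_toList.2 (Finset.mem_filter.2
          ⟨Finset.mem_product.2 ⟨hlab _ _ _ ht, hcode _ _ hv⟩, _, hv, ht⟩), _,
          hvalid _ hd', hT', hd'⟩
  · rintro ⟨q, C⟩ hc x hx
    obtain ⟨w, hw, rfl⟩ := (memN _).1 hc
    obtain ⟨v, hv, ht⟩ := h.exists_track hK (h.path_iff.1 hw).1 hx
    have hp : Path δ q₀ v _ := hv.path (K := K)
    exact ⟨([x], _), Finset.mem_toList.2 (Finset.mem_filter.2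
      ⟨Finset.mem_product.2 ⟨hlab _ _ _ ht, hcode _ _ hp⟩, v, hp, ht⟩), rfl⟩
  · intro r hr
    exact (memΩ _).2 ⟨by simpa using hsum r hr, [], [], .nil, hnil r, rfl⟩
  · rintro ⟨q, t, b⟩ ho ⟨q', x, p⟩ hd rfl ⟨x', t', z⟩ hf rfl
    obtain ⟨hl, u, v, hu, hc, hb⟩ := (memΩ _).1 ho
    refine (memΩ _).2 ⟨(length_of_mem_lifts hf).symm.le.trans hl, _, _, hu.cons hd,
      hc.of_lift hf, ?_⟩
    simp only at hb ⊢
    rw [hb]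
    simp [Bool.decide_and, Bool.and_comm]
  · rintro ⟨q, t, b⟩ ho r hr ht
    obtain ⟨-, u, v, hu, hc, hb⟩ := (memΩ _).1 ho
    obtain ⟨p, hv⟩ := hc.exists_path hu
    have hval := val_eq_of_chain hc ht
    rw [fwd_relator R hr, mul_one] at hval
    have := (h.path_iff.1 hu).1.eq (h.path_iff.1 hv).1 hc.length_eq hval.symm
    simpa [this] using hb

/-- The lexicographically least words of a hyperbolic group are accepted by an automaton with a
coherent action of the group. -/
theorem IsHyperbolic.exists_isCoherent (h : IsHyperbolic R) :
    ∃ q₀ δ T N Ω, IsCoherent (code R) q₀ δ T N Ω ∧ ∀ L, ∀ x ∈ ball R L,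
      ∃ w q, Path δ q₀ w q ∧ w.length = L ∧ val R w = x := by
  obtain ⟨K, hK⟩ := h.fellowTravel
  have hK1 : 1 ≤ K := by
    obtain ⟨w, hw, hl, -⟩ := exists_isLexLeast (R := R) (x := 1) (n := 0) (wordNorm_one R).le
    obtain ⟨v, hv, hl', he⟩ := exists_isLexLeast (R := R) (x := 1) (n := 1)
      ((wordNorm_one R).le.trans (by simp))
    refine (Nat.le_add_left _ _).trans (hK w v none hw hv (none_mem_letters m) (by omega) ?_ 0)
    rw [List.length_eq_zero_iff.1 hl, he]
    simp [val, gen]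
  obtain ⟨N, Ω, hc⟩ := hK.exists_isCoherent hK1
  refine ⟨_, _, _, N, Ω, hc, fun L x hx => ?_⟩
  obtain ⟨w, hw, hl, he⟩ := exists_isLexLeast (R := R) (n := L) hx
  exact ⟨w, _, hw.path, hl, he⟩

end TrueAutomaton

/-! ### Growth of a finite automaton and its loops -/

section Counting

variable {m : ℕ} {δ : Moves}

/-- A path that avoids a set of states. -/
inductive AvoidPath (δ : Moves) (F : Finset ℕ) (q : ℕ) : List Letter → ℕ → Prop
  | nil : q ∉ F → AvoidPath δ F q [] q
  | cons {u : List Letter} {p p' : ℕ} {x : Letter} :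
      AvoidPath δ F q u p → (p, x, p') ∈ δ → p' ∉ F → AvoidPath δ F q (x :: u) p'

theorem AvoidPath.path {F : Finset ℕ} {q p : ℕ} {w : List Letter} (h : AvoidPath δ F q w p) :
    Path δ q w p := by
  induction h with
  | nil => exact .nil
  | cons _ hd _ ih => exact ih.cons hd

theorem Path.avoidPath {q p : ℕ} {w : List Letter} (h : Path δ q w p) : AvoidPath δ ∅ q w p := by
  induction h with
  | nil => exact .nil (by simp)
  | cons _ hd ih => exact ih.cons hd (by simp)

theorem AvoidPath.notMem {F : Finset ℕ} {q p : ℕ} {w : List Letter} (h : AvoidPath δ F q w p) :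
    q ∉ F := by
  induction h with
  | nil h => exact h
  | cons _ _ _ ih => exact ih

/-- A path splits at the last visit of its initial state. -/
theorem AvoidPath.exists_loop {F : Finset ℕ} {q p : ℕ} {w : List Letter}
    (h : AvoidPath δ F q w p) : ∃ l, Path δ q l q ∧ ((w = l ∧ p = q) ∨
      ∃ x p' v, w = v ++ x :: l ∧ (q, x, p') ∈ δ ∧ AvoidPath δ (insert q F) p' v p) := by
  induction h with
  | nil _ => exact ⟨[], .nil, .inl ⟨rfl, rfl⟩⟩
  | @cons u p p' x hu hd hp ih =>
    by_cases hq : p' = q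
    · subst hq
      exact ⟨x :: u, hu.path.cons hd, .inl ⟨rfl, rfl⟩⟩
    · have hq' : p' ∉ insert q F := by simp [hq, hp]
      obtain ⟨l, hl, ⟨rfl, rfl⟩ | ⟨y, p₁, v, rfl, hy, hv⟩⟩ := ih
      · exact ⟨u, hl, .inr ⟨x, p', [], rfl, hd, .nil hq'⟩⟩
      · exact ⟨l, hl, .inr ⟨y, p₁, x :: v, rfl, hy, hv.cons hd hq'⟩⟩

open Classical in
/-- The words of length `n` that label paths from `q` outside `F`. -/
noncomputable def avoidWords (m : ℕ) (δ : Moves) (F : Finset ℕ) (q n : ℕ) :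
    Finset (List Letter) :=
  (allWords m n).toFinset.filter fun w => ∃ p, AvoidPath δ F q w p

theorem mem_avoidWords (hδ : ∀ d ∈ δ, d.2.1 ∈ letters m) {F : Finset ℕ} {q n : ℕ}
    {w : List Letter} :
    w ∈ avoidWords m δ F q n ↔ w.length = n ∧ ∃ p, AvoidPath δ F q w p := by
  simp only [avoidWords, Finset.mem_filter, List.mem_toFinset, mem_allWords]
  constructor
  · rintro ⟨⟨h, -⟩, h'⟩
    exact ⟨h, h'⟩
  · rintro ⟨h, p, hp⟩
    exact ⟨⟨h, hp.path.valid hδ⟩, p, hp⟩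

/-- A path that leaves `q` for good is a loop of length `t`, one transition, and a path of length `n
- 1 - t` that also avoids `q`. -/
theorem avoidWords_subset (hδ : ∀ d ∈ δ, d.2.1 ∈ letters m) (F : Finset ℕ) (q n : ℕ) :
    avoidWords m δ F q n ⊆ (loops m δ q n).toFinset ∪ (Finset.range n).biUnion fun t =>
      (δ.toFinset.filter fun d => d.1 = q).biUnion fun d =>
        Finset.image₂ (fun l v => v ++ d.2.1 :: l)
        (loops m δ q t).toFinset (avoidWords m δ (insert q F) d.2.2 (n - 1 - t)) := by
  intro w hw
  obtain ⟨rfl, p, hp⟩ := (mem_avoidWords hδ).1 hw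
  obtain ⟨l, hl, ⟨rfl, rfl⟩ | ⟨x, p', v, rfl, hx, hv⟩⟩ := hp.exists_loop
  · exact Finset.mem_union_left _ (List.mem_toFinset.2 (mem_loops.2 ⟨⟨rfl, hl.valid hδ⟩, hl⟩))
  · refine Finset.mem_union_right _ (Finset.mem_biUnion.2 ⟨l.length, ?_,
      Finset.mem_biUnion.2 ⟨(q, x, p'), by simpa using hx,
        Finset.mem_image₂.2 ⟨l, ?_, v, ?_, rfl⟩⟩⟩)
    · simp
      omega
    · exact List.mem_toFinset.2 (mem_loops.2 ⟨⟨rfl, hl.valid hδ⟩, hl⟩)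
    · refine (mem_avoidWords hδ).2 ⟨?_, p, hv⟩
      simp

theorem card_avoidWords_le (hδ : ∀ d ∈ δ, d.2.1 ∈ letters m) {γ : ℝ} (hγ : 1 ≤ γ) {q₀ : ℕ}
    (hloop : ∀ q k u, Path δ q₀ u q → ((loops m δ q k).length : ℝ) ≤ γ ^ k)
    {Q : Finset ℕ} (hQ : ∀ q u, Path δ q₀ u q → q ∈ Q) (j : ℕ) (F : Finset ℕ)
    (hF : (Q \ F).card ≤ j) (q n : ℕ) {u : List Letter} (hu : Path δ q₀ u q) :
    ((avoidWords m δ F q n).card : ℝ) ≤ ((δ.length + 1) * (n + 1)) ^ j * γ ^ n := by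
  have hγ0 : 0 ≤ γ := zero_le_one.trans hγ
  induction j generalizing F q n u with
  | zero =>
    have hq : q ∈ F := by
      by_contra hq
      have : q ∈ Q \ F := Finset.mem_sdiff.2 ⟨hQ _ _ hu, hq⟩
      rw [Finset.card_eq_zero.1 (Nat.le_zero.1 hF)] at this
      simp at this
    have : avoidWords m δ F q n = ∅ := by
      refine Finset.eq_empty_of_forall_notMem fun w hw => ?_
      obtain ⟨-, p, hp⟩ := (mem_avoidWords hδ).1 hw
      exact hp.notMem hq
    rw [this]
    simp only [Finset.card_empty, Nat.cast_zero]
    positivity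
  | succ j ih =>
    by_cases hq : q ∈ F
    · have : avoidWords m δ F q n = ∅ := by
        refine Finset.eq_empty_of_forall_notMem fun w hw => ?_
        obtain ⟨-, p, hp⟩ := (mem_avoidWords hδ).1 hw
        exact hp.notMem hq
      rw [this]
      simp only [Finset.card_empty, Nat.cast_zero]
      positivity
    have hF' : (Q \ insert q F).card ≤ j := by
      have : Q \ insert q F ⊂ Q \ F := by
        refine Finset.ssubset_iff_subset_ne.2 ⟨Finset.sdiff_subset_sdiff le_rfl
          (Finset.subset_insert _ _), fun he => ?_⟩
        have : q ∈ Q \ F := Finset.mem_sdiff.2 ⟨hQ _ _ hu, hq⟩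
        rw [← he] at this
        simp at this
      have := Finset.card_lt_card this
      omega
    set D : ℝ := (δ.length + 1) * (n + 1) with hD
    have hD1 : 1 ≤ D := by
      have h1 : (1 : ℝ) ≤ δ.length + 1 := by simp
      have h2 : (1 : ℝ) ≤ n + 1 := by simp
      nlinarith
    have hterm : ∀ t ∈ Finset.range n, ∀ d ∈ δ.toFinset.filter fun d => d.1 = q,
        ((Finset.image₂ (fun l v => v ++ d.2.1 :: l) (loops m δ q t).toFinset
          (avoidWords m δ (insert q F) d.2.2 (n - 1 - t))).card : ℝ) ≤ D ^ j * γ ^ n := by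
      intro t ht d hd
      have ht' : t < n := Finset.mem_range.1 ht
      have h1 : ((avoidWords m δ (insert q F) d.2.2 (n - 1 - t)).card : ℝ) ≤
          D ^ j * γ ^ (n - 1 - t) := by
        obtain ⟨hd, hqd⟩ := Finset.mem_filter.1 hd
        refine (ih (insert q F) hF' d.2.2 (n - 1 - t)
          (hu.cons (x := d.2.1) (hqd ▸ List.mem_toFinset.1 hd))).trans ?_
        have : ((n - 1 - t : ℕ) : ℝ) ≤ n := by exact_mod_cast (by omega : n - 1 - t ≤ n)
        rw [hD]
        gcongr
      have h2 : ((loops m δ q t).toFinset.card : ℝ) ≤ γ ^ t :=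
        le_trans (by exact_mod_cast List.toFinset_card_le _) (hloop q t u hu)
      calc _ ≤ ((loops m δ q t).toFinset.card : ℝ) *
            (avoidWords m δ (insert q F) d.2.2 (n - 1 - t)).card := by
            exact_mod_cast Finset.card_image₂_le _ _ _
        _ ≤ γ ^ t * (D ^ j * γ ^ (n - 1 - t)) := by gcongr
        _ = D ^ j * γ ^ (t + (n - 1 - t)) := by rw [pow_add]; ring
        _ ≤ D ^ j * γ ^ n := by
          gcongr
          omega
    have hsum : (((Finset.range n).biUnion fun t =>
        (δ.toFinset.filter fun d => d.1 = q).biUnion fun d =>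
        Finset.image₂ (fun l v => v ++ d.2.1 :: l) (loops m δ q t).toFinset
          (avoidWords m δ (insert q F) d.2.2 (n - 1 - t))).card : ℝ) ≤
        n * (δ.length * (D ^ j * γ ^ n)) := by
      refine (Nat.cast_le.2 Finset.card_biUnion_le).trans ?_
      rw [Nat.cast_sum]
      refine (Finset.sum_le_card_nsmul _ _ _ fun t ht =>
        (Nat.cast_le.2 Finset.card_biUnion_le).trans ?_).trans_eq
          (by rw [Finset.card_range, nsmul_eq_mul])
      rw [Nat.cast_sum]
      refine (Finset.sum_le_card_nsmul _ _ _ (hterm t ht)).trans ?_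
      rw [nsmul_eq_mul]
      gcongr
      exact (Finset.card_filter_le _ _).trans (List.toFinset_card_le _)
    calc ((avoidWords m δ F q n).card : ℝ) ≤ γ ^ n + n * (δ.length * (D ^ j * γ ^ n)) := by
          have h3 := (Finset.card_le_card (avoidWords_subset hδ F q n)).trans
            (Finset.card_union_le _ _)
          have h4 : ((avoidWords m δ F q n).card : ℝ) ≤ _ := Nat.cast_le.2 h3
          rw [Nat.cast_add] at h4
          refine h4.trans (add_le_add ?_ hsum)
          exact le_trans (by exact_mod_cast List.toFinset_card_le _) (hloop q n u hu)
      _ ≤ D ^ j * γ ^ n + n * (δ.length * (D ^ j * γ ^ n)) := by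
          gcongr
          exact le_mul_of_one_le_left (by positivity) (one_le_pow₀ hD1)
      _ = (1 + n * δ.length) * (D ^ j * γ ^ n) := by ring
      _ ≤ D * (D ^ j * γ ^ n) := by
          gcongr
          rw [hD]
          have : (0 : ℝ) ≤ n := by positivity
          have : (0 : ℝ) ≤ δ.length := by positivity
          nlinarith
      _ = D ^ (j + 1) * γ ^ n := by ring

/-- If an automaton accepts at least `β ^ n` words of each length `n`, then the numbers of loops at
some state exceed every smaller rate of growth. -/
theorem exists_loops (hδ : ∀ d ∈ δ, d.2.1 ∈ letters m) {β γ : ℝ} (hγ : 1 ≤ γ) (hβ : γ < β) {q₀ : ℕ}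
    (hcount : ∀ n, ∃ Z : Finset (List Letter), β ^ n ≤ Z.card ∧
      ∀ w ∈ Z, w.length = n ∧ ∃ q, Path δ q₀ w q) :
    ∃ q k u, Path δ q₀ u q ∧ γ ^ k < (loops m δ q k).length := by
  -- Otherwise the number of accepted words of length `n` is at most a polynomial in `n` times `γ ^
  -- n`, which is eventually smaller than `β ^ n`.
  by_contra! hcon
  set Q : Finset ℕ := insert q₀ (δ.map fun d => d.2.2).toFinset
  have hQ : ∀ q u, Path δ q₀ u q → q ∈ Q := by
    intro q u h
    cases h with
    | nil => simp [Q]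
    | cons _ hd =>
      refine Finset.mem_insert_of_mem (List.mem_toFinset.2 (List.mem_map.2 ⟨_, hd, rfl⟩))
  have hγ0 : 0 < γ := zero_lt_one.trans_le hγ
  have hβ0 : 0 < β := hγ0.trans hβ
  set s := (Q \ ∅).card
  have hle : ∀ n : ℕ, β ^ n ≤ ((δ.length + 1) * (n + 1)) ^ s * γ ^ n := by
    intro n
    obtain ⟨Z, hZ, hw⟩ := hcount n
    refine hZ.trans (le_trans ?_ (card_avoidWords_le hδ hγ
      (fun q k u hu => hcon q k u hu) hQ s ∅ le_rfl q₀ n .nil))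
    refine Nat.cast_le.2 (Finset.card_le_card fun w hwZ => (mem_avoidWords hδ).2 ?_)
    obtain ⟨hl, q, hq⟩ := hw w hwZ
    exact ⟨hl, q, hq.avoidPath⟩
  set r := γ / β
  have hr0 : 0 < r := div_pos hγ0 hβ0
  have hr1 : r < 1 := (div_lt_one hβ0).2 hβ
  have hlim := ((tendsto_pow_const_mul_const_pow_of_abs_lt_one s
    (by rwa [abs_of_pos hr0] : |r| < 1)).comp (tendsto_add_atTop_nat 1)).const_mul
      (((δ.length : ℝ) + 1) ^ s * r⁻¹)
  rw [mul_zero] at hlim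
  obtain ⟨n, hn⟩ := (hlim.eventually (gt_mem_nhds zero_lt_one)).exists
  refine absurd hn (not_lt.2 ?_)
  have h1 := hle n
  rw [mul_pow, ← div_le_iff₀ (pow_pos hγ0 n)] at h1
  have h2 : β ^ n / γ ^ n = (r ^ n)⁻¹ := by
    rw [div_pow, inv_div]
  rw [h2] at h1
  have h3 : 0 < r ^ n := pow_pos hr0 n
  rw [inv_le_iff_one_le_mul₀ h3] at h1
  refine h1.trans_eq ?_
  simp only [Function.comp_apply, Nat.cast_add, Nat.cast_one, pow_succ r n]
  field_simp

end Counting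

/-! ### The growth exponent and its certificates -/

section Growth

variable {m : ℕ} (R : List (GenWord m))

theorem ncard_ball_pos (L : ℕ) : 0 < (ball R L).ncard :=
  (Set.ncard_pos (finite_ball R L)).2 ⟨1, by simp [ball, wordNorm_one]⟩

theorem ncard_ball_add_le (K L : ℕ) :
    (ball R (K + L)).ncard ≤ (ball R K).ncard * (ball R L).ncard := by
  have hsub : ball R (K + L) ⊆ (fun p : Grp m R × Grp m R => p.1 * p.2) ''
      (ball R K ×ˢ ball R L) := by
    intro x hx
    obtain ⟨w, rfl, hw⟩ := exists_word R x
    have hl : w.length ≤ K + L := hw.trans_le hx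
    refine ⟨(value R (w.take K), value R (w.drop K)),
      ⟨(wordNorm_value_le R _).trans (by simp), (wordNorm_value_le R _).trans ?_⟩, ?_⟩
    · simp
      omega
    · simp [← value_append]
  have hfin := (finite_ball R K).prod (finite_ball R L)
  refine (Set.ncard_le_ncard hsub (hfin.image _)).trans ((Set.ncard_image_le hfin).trans ?_)
  rw [Set.ncard_prod]

/-- The logarithm of the size of the balls. -/
noncomputable def logBall (L : ℕ) : ℝ := Real.logb (2 * (m : ℝ) - 1) ((ball R L).ncard : ℝ)

variable {R}

theorem one_lt_base (hm : 2 ≤ m) : 1 < 2 * (m : ℝ) - 1 := by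
  have : (2 : ℝ) ≤ m := by exact_mod_cast hm
  linarith

theorem logBall_nonneg (hm : 2 ≤ m) (L : ℕ) : 0 ≤ logBall R L :=
  Real.logb_nonneg (one_lt_base hm) (by exact_mod_cast ncard_ball_pos R L)

theorem subadditive_logBall (hm : 2 ≤ m) : Subadditive (logBall R) := by
  intro K L
  have hK : (0 : ℝ) < (ball R K).ncard := by exact_mod_cast ncard_ball_pos R K
  have hL : (0 : ℝ) < (ball R L).ncard := by exact_mod_cast ncard_ball_pos R L
  unfold logBall
  rw [← Real.logb_mul hK.ne' hL.ne']
  refine Real.logb_le_logb_of_le (one_lt_base hm) (by exact_mod_cast ncard_ball_pos R _) ?_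
  exact_mod_cast ncard_ball_add_le R K L

theorem bddBelow_logBall (hm : 2 ≤ m) : BddBelow (Set.range fun n => logBall R n / n) := by
  refine ⟨0, ?_⟩
  rintro _ ⟨n, rfl⟩
  exact div_nonneg (logBall_nonneg hm n) (Nat.cast_nonneg n)

theorem hasGrowthExponent_iff {g : ℝ} :
    HasGrowthExponent R g ↔ Tendsto (fun L : ℕ => logBall R L / L) atTop (𝓝 g) := by
  unfold HasGrowthExponent logBall
  simp only [one_div, inv_mul_eq_div]

/-- The growth exponent exists. -/
theorem exists_hasGrowthExponent (hm : 2 ≤ m) : ∃ g, HasGrowthExponent R g :=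
  ⟨_, hasGrowthExponent_iff.2
    ((subadditive_logBall (R := R) hm).tendsto_lim (bddBelow_logBall hm))⟩

theorem HasGrowthExponent.nonneg (hm : 2 ≤ m) {g : ℝ} (h : HasGrowthExponent R g) : 0 ≤ g :=
  ge_of_tendsto' (hasGrowthExponent_iff.1 h) fun n =>
    div_nonneg (logBall_nonneg hm n) (Nat.cast_nonneg n)

/-- By Fekete's lemma the limit is the infimum of `logBall R L / L` over positive `L`. -/
theorem HasGrowthExponent.mul_le_logBall (hm : 2 ≤ m) {g : ℝ} (h : HasGrowthExponent R g)
    (L : ℕ) : g * L ≤ logBall R L := by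
  rcases Nat.eq_zero_or_pos L with rfl | hL
  · simpa using logBall_nonneg hm 0
  · have hsub := subadditive_logBall (R := R) hm
    have hg := tendsto_nhds_unique (hasGrowthExponent_iff.1 h)
      (hsub.tendsto_lim (bddBelow_logBall hm))
    rw [hg, ← le_div_iff₀ (by exact_mod_cast hL)]
    exact hsub.lim_le_div (bddBelow_logBall hm) hL.ne'

/-- If the ball of radius `l + k * j` has at least `c ^ j` elements for all `j`, then the growth
exponent is at least `log c / k`. -/
theorem HasGrowthExponent.logb_le (hm : 2 ≤ m) {g : ℝ} (h : HasGrowthExponent R g) {l k c : ℕ}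
    (hk : k ≠ 0) (hc : 0 < c) (hle : ∀ j, c ^ j ≤ (ball R (l + k * j)).ncard) :
    Real.logb (2 * (m : ℝ) - 1) c ≤ k * g := by
  have hk0 : 0 < k := Nat.pos_of_ne_zero hk
  have hto : Tendsto (fun j : ℕ => l + k * j) atTop atTop :=
    tendsto_atTop_mono (fun j => (Nat.le_mul_of_pos_left j hk0).trans (Nat.le_add_left _ _))
      tendsto_id
  have h1 := (hasGrowthExponent_iff.1 h).comp hto
  have h2 : Tendsto (fun j : ℕ => (l : ℝ) / j + k) atTop (𝓝 (0 + k)) :=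
    (tendsto_const_div_atTop_nhds_zero_nat (l : ℝ)).add_const _
  have h3 := h2.mul h1
  rw [zero_add] at h3
  refine ge_of_tendsto h3 ?_
  filter_upwards [eventually_gt_atTop 0] with j hj
  have hj0 : (0 : ℝ) < j := by exact_mod_cast hj
  have hM : (0 : ℝ) < l + k * j := by
    have : (0 : ℝ) < k := by exact_mod_cast hk0
    positivity
  have h4 : (j : ℝ) * Real.logb (2 * (m : ℝ) - 1) c ≤ logBall R (l + k * j) := by
    rw [← Real.logb_pow]
    refine Real.logb_le_logb_of_le (one_lt_base hm) (by positivity) ?_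
    exact_mod_cast hle j
  simp only [Function.comp_apply, Nat.cast_add, Nat.cast_mul]
  rw [show ((l : ℝ) / j + k) * (logBall R (l + k * j) / (l + k * j)) =
    logBall R (l + k * j) / j by field_simp]
  rw [le_div_iff₀ hj0, mul_comm]
  exact h4

/-- A number, a coherent automaton with a state at which there are many loops, and a cover of a
ball. -/
abbrev Certificate : Type :=
  ℕ × (ℕ × Moves × Tracks × List (ℕ × Claims) × List (ℕ × Claims × Bool)) ×
    (ℕ × ℕ × List Letter) × ℕ × List (List Letter) ×
      List (List Letter × List (ℕ × List Letter × Bool))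

/-- The automaton of the certificate proves the lower bound `(p - 1) / 2 ^ n` for the growth
exponent. -/
def LowerBound (P : Presentation) (n p q₀ : ℕ) (δ : Moves) (s : ℕ × ℕ × List Letter) : Prop :=
  s.1 ∈ endpoints δ q₀ s.2.2 ∧ s.2.1 ≠ 0 ∧
    -- This is `(p - 1) / 2 ^ n ≤ log c / k` with denominators and logarithms cleared, a comparison
    -- of natural numbers. For `p = 0` the truncated `p - 1` is 0.
    (2 * P.1 - 1) ^ (s.2.1 * (p - 1)) ≤ (loops P.1 δ s.1 s.2.1).length ^ 2 ^ n

/-- The cover of the certificate proves the upper bound `(p + 1) / 2 ^ n` for the growth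
exponent. -/
def UpperBound (P : Presentation) (n p L : ℕ) (C : List (List Letter))
    (E : List (List Letter × List (ℕ × List Letter × Bool))) : Prop :=
  L ≠ 0 ∧ IsCover P L C E ∧ C.length ^ 2 ^ n ≤ (2 * P.1 - 1) ^ (L * (p + 1))

/-- The certificate proves that `p / 2 ^ n` is close to the growth exponent. -/
def IsCertificate (P : Presentation) (n : ℕ) (c : Certificate) : Prop :=
  IsCoherent P c.2.1.1 c.2.1.2.1 c.2.1.2.2.1 c.2.1.2.2.2.1 c.2.1.2.2.2.2 ∧
    LowerBound P n c.1 c.2.1.1 c.2.1.2.1 c.2.2.1 ∧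
      UpperBound P n c.1 c.2.2.2.1 c.2.2.2.2.1 c.2.2.2.2.2

theorem cast_base (hm : 2 ≤ m) : ((2 * m - 1 : ℕ) : ℝ) = 2 * (m : ℝ) - 1 := by
  rw [Nat.cast_sub (by omega)]
  simp

theorem logb_base_pow (hm : 2 ≤ m) (e : ℕ) :
    Real.logb (2 * (m : ℝ) - 1) (((2 * m - 1 : ℕ) : ℝ) ^ e) = e := by
  have h1 := one_lt_base hm
  rw [cast_base hm, Real.logb_pow, Real.logb_self_eq_one h1, mul_one]

theorem LowerBound.le (hm : 2 ≤ m) {g : ℝ} (hg : HasGrowthExponent R g) {n p q₀ : ℕ} {δ : Moves}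
    {T : Tracks} {N : List (ℕ × Claims)} {Ω : List (ℕ × Claims × Bool)} {s : ℕ × ℕ × List Letter}
    (hc : IsCoherent (code R) q₀ δ T N Ω) (h : LowerBound (code R) n p q₀ δ s) :
    ((p : ℝ) - 1) / 2 ^ n ≤ g := by
  obtain ⟨h1, h2, h3⟩ := h
  change (2 * m - 1) ^ (s.2.1 * (p - 1)) ≤ (loops m δ s.1 s.2.1).length ^ 2 ^ n at h3
  have hb := one_lt_base hm
  have hbn : 0 < 2 * m - 1 := by omega
  have hpos : 0 < (loops m δ s.1 s.2.1).length := by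
    refine Nat.pos_of_ne_zero fun h0 => ?_
    rw [h0, zero_pow (by positivity)] at h3
    exact absurd h3 (not_le.2 (pow_pos hbn _))
  have h4 := hg.logb_le hm h2 hpos (hc.loops_pow_le (mem_endpoints.1 h1) s.2.1)
  have h5 : (((2 * m - 1 : ℕ) : ℝ)) ^ (s.2.1 * (p - 1)) ≤
      ((loops m δ s.1 s.2.1).length : ℝ) ^ 2 ^ n := by exact_mod_cast h3
  have h6 := Real.logb_le_logb_of_le hb (pow_pos (by exact_mod_cast hbn) _) h5
  rw [logb_base_pow hm, Real.logb_pow] at h6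
  push_cast at h6
  have hk : (0 : ℝ) < s.2.1 := by exact_mod_cast Nat.pos_of_ne_zero h2
  have h7 : ((p - 1 : ℕ) : ℝ) ≤ 2 ^ n * g := by
    refine le_of_mul_le_mul_left ?_ hk
    calc (s.2.1 : ℝ) * ((p - 1 : ℕ) : ℝ) ≤ 2 ^ n * _ := h6
      _ ≤ 2 ^ n * (s.2.1 * g) := by gcongr
      _ = _ := by ring
  have h8 : (p : ℝ) - 1 ≤ ((p - 1 : ℕ) : ℝ) := by
    have : p ≤ p - 1 + 1 := by omega
    have : (p : ℝ) ≤ ((p - 1 : ℕ) : ℝ) + 1 := by exact_mod_cast this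
    linarith
  rw [div_le_iff₀ (by positivity), mul_comm]
  exact h8.trans h7

theorem UpperBound.le (hm : 2 ≤ m) {g : ℝ} (hg : HasGrowthExponent R g) {n p L : ℕ}
    {C : List (List Letter)} {E : List (List Letter × List (ℕ × List Letter × Bool))}
    (h : UpperBound (code R) n p L C E) : g ≤ ((p : ℝ) + 1) / 2 ^ n := by
  obtain ⟨h1, h2, h3⟩ := h
  change C.length ^ 2 ^ n ≤ (2 * m - 1) ^ (L * (p + 1)) at h3
  have h4 : (ball R L).ncard ^ 2 ^ n ≤ (2 * m - 1) ^ (L * (p + 1)) :=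
    (Nat.pow_le_pow_left h2.ncard_ball_le _).trans h3
  have h5 : ((ball R L).ncard : ℝ) ^ 2 ^ n ≤ ((2 * m - 1 : ℕ) : ℝ) ^ (L * (p + 1)) := by
    exact_mod_cast h4
  have hpos : (0 : ℝ) < (ball R L).ncard := by exact_mod_cast ncard_ball_pos R L
  have h6 := Real.logb_le_logb_of_le (one_lt_base hm) (pow_pos hpos _) h5
  rw [logb_base_pow hm, Real.logb_pow] at h6
  push_cast at h6
  have hL : (0 : ℝ) < L := by exact_mod_cast Nat.pos_of_ne_zero h1
  rw [le_div_iff₀ (by positivity)]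
  refine le_of_mul_le_mul_left ?_ hL
  calc (L : ℝ) * (g * 2 ^ n) = 2 ^ n * (g * L) := by ring
    _ ≤ 2 ^ n * logBall R L := by
      gcongr
      exact hg.mul_le_logBall hm L
    _ ≤ _ := h6

theorem IsCertificate.abs_sub_le (hm : 2 ≤ m) {g : ℝ} (hg : HasGrowthExponent R g) {n : ℕ}
    {c : Certificate} (h : IsCertificate (code R) n c) : |g - (c.1 : ℝ) / 2 ^ n| ≤ 1 / 2 ^ n := by
  have h1 := h.2.1.le hm hg h.1
  have h2 := h.2.2.le hm hg
  rw [sub_div] at h1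
  rw [add_div] at h2
  rw [abs_le]
  constructor <;> linarith

theorem exists_lowerBound (hm : 2 ≤ m) {g : ℝ} (hg : HasGrowthExponent R g) {n p q₀ : ℕ}
    {δ : Moves} {T : Tracks} {N : List (ℕ × Claims)} {Ω : List (ℕ × Claims × Bool)}
    (hc : IsCoherent (code R) q₀ δ T N Ω)
    (hw : ∀ L, ∀ x ∈ ball R L, ∃ w q, Path δ q₀ w q ∧ w.length = L ∧ val R w = x)
    (hp : (p : ℝ) ≤ g * 2 ^ n) : ∃ s, LowerBound (code R) n p q₀ δ s := by
  have hb := one_lt_base hm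
  have hb0 : 0 < 2 * (m : ℝ) - 1 := zero_lt_one.trans hb
  rcases Nat.eq_zero_or_pos p with rfl | hp0
  -- The exponent is 0 here, so a single loop suffices, and padding provides one.
  · refine ⟨(q₀, 1, []), mem_endpoints.2 .nil, one_ne_zero, ?_⟩
    have : [none] ∈ loops m δ q₀ 1 :=
      mem_loops.2 ⟨⟨rfl, by simp [none_mem_letters]⟩, Path.nil.cons hc.pad⟩
    simpa using (Nat.one_le_pow _ _ (List.length_pos_of_mem this) :
      1 ≤ (loops (code R).1 δ q₀ 1).length ^ 2 ^ n)
  · set e : ℝ := ((p - 1 : ℕ) : ℝ) / 2 ^ n with he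
    -- The tolerance `p - 1` makes the required rate strictly smaller than the true one, as
    -- `exists_loops` demands.
    have hlt : e < g := by
      rw [he, div_lt_iff₀ (by positivity)]
      refine lt_of_lt_of_le ?_ hp
      exact_mod_cast Nat.sub_lt hp0 one_pos
    have h1 : 1 ≤ (2 * (m : ℝ) - 1) ^ e := Real.one_le_rpow hb.le (by positivity)
    obtain ⟨q, k, u, hu, hk⟩ := exists_loops hc.valid h1
      (Real.rpow_lt_rpow_of_exponent_lt hb hlt) (q₀ := q₀) fun L => by
        choose! f q hf using hw L
        have hinj : Set.InjOn f (ball R L) := fun x hx y hy hxy => by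
          rw [← (hf x hx).2.2, ← (hf y hy).2.2, hxy]
        refine ⟨((finite_ball R L).image f).toFinset, ?_, fun w hw => ?_⟩
        · rw [← Set.ncard_eq_toFinset_card _ ((finite_ball R L).image f),
            hinj.ncard_image, ← Real.rpow_natCast, ← Real.rpow_mul hb0.le,
            ← Real.le_logb_iff_rpow_le hb (by exact_mod_cast ncard_ball_pos R L)]
          exact hg.mul_le_logBall hm L
        · obtain ⟨x, hx, rfl⟩ := (Set.Finite.mem_toFinset _).1 hw
          exact ⟨(hf x hx).2.1, _, (hf x hx).1⟩
    change _ < ((loops m δ q k).length : ℝ) at hk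
    refine ⟨(q, k, u), mem_endpoints.2 hu, ?_, ?_⟩
    -- There is at most one loop of length 0, whereas the strict inequality asks for more than one.
    · rintro rfl
      have : (loops m δ q 0).length ≤ 1 := by
        refine (List.length_filter_le _ _).trans ?_
        simp [allWords]
      have h2 : ((loops m δ q 0).length : ℝ) ≤ 1 := by exact_mod_cast this
      have h3 : (1 : ℝ) < (loops m δ q 0).length := by
        simpa using hk
      linarith
    · change (2 * m - 1) ^ (k * (p - 1)) ≤ (loops m δ q k).length ^ 2 ^ n
      have h2 : ((2 * m - 1 : ℕ) : ℝ) ^ (k * (p - 1)) ≤ ((loops m δ q k).length : ℝ) ^ 2 ^ n := by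
        calc ((2 * m - 1 : ℕ) : ℝ) ^ (k * (p - 1))
            = (((2 * (m : ℝ) - 1) ^ e) ^ k) ^ 2 ^ n := by
              rw [cast_base hm, ← pow_mul, ← Real.rpow_natCast, ← Real.rpow_natCast,
                ← Real.rpow_mul hb0.le, he]
              congr 1
              push_cast
              field_simp
          _ ≤ _ := pow_le_pow_left₀ (by positivity) (by exact_mod_cast hk.le) _
      exact_mod_cast h2

theorem exists_upperBound (hm : 2 ≤ m) {g : ℝ} (hg : HasGrowthExponent R g) {n p : ℕ}
    (hp : g * 2 ^ n < p + 1) : ∃ L C E, UpperBound (code R) n p L C E := by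
  have hlt : g < ((p : ℝ) + 1) / 2 ^ n := by rwa [lt_div_iff₀ (by positivity)]
  obtain ⟨L, hL, hL0⟩ := (((hasGrowthExponent_iff.1 hg).eventually (gt_mem_nhds hlt)).and
    (eventually_gt_atTop 0)).exists
  obtain ⟨C, E, hC, hl⟩ := exists_isCover R L
  refine ⟨L, C, E, hL0.ne', hC, ?_⟩
  change C.length ^ 2 ^ n ≤ (2 * m - 1) ^ (L * (p + 1))
  rw [hl]
  have hpos : (0 : ℝ) < (ball R L).ncard := by exact_mod_cast ncard_ball_pos R L
  have hbn : (0 : ℝ) < (2 * m - 1 : ℕ) := by exact_mod_cast (by omega : 0 < 2 * m - 1)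
  have h2 : ((ball R L).ncard : ℝ) ^ 2 ^ n ≤ ((2 * m - 1 : ℕ) : ℝ) ^ (L * (p + 1)) := by
    rw [← Real.logb_le_logb (one_lt_base hm) (by positivity) (by positivity), logb_base_pow hm,
      Real.logb_pow]
    rw [div_lt_div_iff₀ (by exact_mod_cast hL0) (by positivity)] at hL
    push_cast
    have : logBall R L * 2 ^ n ≤ (p + 1) * L := hL.le
    rw [mul_comm, mul_comm (L : ℝ)]
    exact this
  exact_mod_cast h2

/-- The witness is `p = ⌊g * 2 ^ n⌋₊`: `p ≤ g * 2 ^ n` gives the lower bound and `g * 2 ^ n < p + 1`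
the upper one. -/
theorem exists_isCertificate (hm : 2 ≤ m) (hR : IsHyperbolic R) (n : ℕ) :
    ∃ c, IsCertificate (code R) n c := by
  obtain ⟨g, hg⟩ := exists_hasGrowthExponent (R := R) hm
  obtain ⟨q₀, δ, T, N, Ω, hc, hw⟩ := hR.exists_isCoherent
  have h0 : 0 ≤ g * 2 ^ n := mul_nonneg (hg.nonneg hm) (by positivity)
  obtain ⟨s, hs⟩ := exists_lowerBound hm hg hc hw (Nat.floor_le h0)
  obtain ⟨L, C, E, hu⟩ := exists_upperBound hm hg (Nat.lt_floor_add_one (g * 2 ^ n))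
  exact ⟨(⌊g * 2 ^ n⌋₊, (q₀, δ, T, N, Ω), s, L, C, E), hc, hs, hu⟩

end Growth

/-! ### Checking a certificate is primitive recursive -/

section PrimitiveRecursion

attribute [fun_prop] Primrec
attribute [fun_prop] Primrec.id Primrec.const Primrec.comp

variable {α β γ σ : Type} [Primcodable α] [Primcodable β] [Primcodable γ] [Primcodable σ]

@[fun_prop]
theorem primrec_fst {f : α → β × γ} (hf : Primrec f) : Primrec fun a => (f a).1 :=
  Primrec.fst.comp hf

@[fun_prop]
theorem primrec_snd {f : α → β × γ} (hf : Primrec f) : Primrec fun a => (f a).2 :=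
  Primrec.snd.comp hf

@[fun_prop]
theorem primrec_mk {f : α → β} {g : α → γ} (hf : Primrec f) (hg : Primrec g) :
    Primrec fun a => (f a, g a) :=
  Primrec.pair hf hg

@[fun_prop]
theorem primrec_cons {f : α → β} {g : α → List β} (hf : Primrec f) (hg : Primrec g) :
    Primrec fun a => f a :: g a :=
  Primrec.list_cons.comp hf hg

@[fun_prop]
theorem primrec_append {f g : α → List β} (hf : Primrec f) (hg : Primrec g) :
    Primrec fun a => f a ++ g a :=
  Primrec.list_append.comp hf hg

@[fun_prop]
theorem primrec_some {f : α → β} (hf : Primrec f) : Primrec fun a => some (f a) :=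
  Primrec.option_some.comp hf

@[fun_prop]
theorem primrec_length {f : α → List β} (hf : Primrec f) : Primrec fun a => (f a).length :=
  Primrec.list_length.comp hf

@[fun_prop]
theorem primrec_range {f : α → ℕ} (hf : Primrec f) : Primrec fun a => List.range (f a) :=
  Primrec.list_range.comp hf

@[fun_prop]
theorem primrec_add {f g : α → ℕ} (hf : Primrec f) (hg : Primrec g) :
    Primrec fun a => f a + g a :=
  Primrec.nat_add.comp hf hg

@[fun_prop]
theorem primrec_sub {f g : α → ℕ} (hf : Primrec f) (hg : Primrec g) :
    Primrec fun a => f a - g a :=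
  Primrec.nat_sub.comp hf hg

@[fun_prop]
theorem primrec_mul {f g : α → ℕ} (hf : Primrec f) (hg : Primrec g) :
    Primrec fun a => f a * g a :=
  Primrec.nat_mul.comp hf hg

@[fun_prop]
theorem primrec_pow {f g : α → ℕ} (hf : Primrec f) (hg : Primrec g) :
    Primrec fun a => f a ^ g a :=
  (Primrec₂.unpaired'.1 Nat.Primrec.pow).comp hf hg

@[fun_prop]
theorem primrec_take {f : α → ℕ} {g : α → List β} (hf : Primrec f) (hg : Primrec g) :
    Primrec fun a => (g a).take (f a) :=
  Primrec.list_take.comp hf hg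

@[fun_prop]
theorem primrec_drop {f : α → ℕ} {g : α → List β} (hf : Primrec f) (hg : Primrec g) :
    Primrec fun a => (g a).drop (f a) :=
  Primrec.list_drop.comp hf hg

@[fun_prop]
theorem primrec_and {f g : α → Bool} (hf : Primrec f) (hg : Primrec g) :
    Primrec fun a => f a && g a :=
  Primrec.and.comp hf hg

theorem primrec_map {f : α → List β} {g : α → β → γ} (hf : Primrec f)
    (hg : Primrec fun x : α × β => g x.1 x.2) : Primrec fun a => (f a).map (g a) :=
  Primrec.list_map hf hg

theorem primrec_flatMap {f : α → List β} {g : α → β → List γ} (hf : Primrec f)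
    (hg : Primrec fun x : α × β => g x.1 x.2) : Primrec fun a => (f a).flatMap (g a) :=
  Primrec.list_flatMap hf hg

theorem primrec_filterMap {f : α → List β} {g : α → β → Option γ} (hf : Primrec f)
    (hg : Primrec fun x : α × β => g x.1 x.2) : Primrec fun a => (f a).filterMap (g a) :=
  Primrec.listFilterMap hf hg

theorem primrec_foldr {f : α → List β} {g : α → σ} {h : α → β → σ → σ} (hf : Primrec f)
    (hg : Primrec g) (hh : Primrec fun x : α × β × σ => h x.1 x.2.1 x.2.2) :
    Primrec fun a => (f a).foldr (h a) (g a) :=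
  Primrec.list_foldr (h := fun a p => h a p.1 p.2) hf hg hh

theorem primrec_foldl {f : α → List β} {g : α → σ} {h : α → σ → β → σ} (hf : Primrec f)
    (hg : Primrec g) (hh : Primrec fun x : α × σ × β => h x.1 x.2.1 x.2.2) :
    Primrec fun a => (f a).foldl (h a) (g a) :=
  Primrec.list_foldl (h := fun a p => h a p.1 p.2) hf hg hh

theorem primrecPred_eq {f g : α → β} (hf : Primrec f) (hg : Primrec g) :
    PrimrecPred fun a => f a = g a :=
  PrimrecRel.comp Primrec.eq hf hg

theorem primrecPred_le {f g : α → ℕ} (hf : Primrec f) (hg : Primrec g) :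
    PrimrecPred fun a => f a ≤ g a :=
  PrimrecRel.comp Primrec.nat_le hf hg

theorem primrecPred_forall {f : α → List β} {p : α → β → Prop} (hf : Primrec f)
    (hp : PrimrecPred fun x : α × β => p x.1 x.2) : PrimrecPred fun a => ∀ b ∈ f a, p a b := by
  have h : PrimrecRel fun (b : β) (a : α) => p a b :=
    PrimrecPred.comp hp (Primrec.pair Primrec.snd Primrec.fst)
  exact PrimrecRel.comp h.forall_mem_list hf Primrec.id

theorem primrecPred_exists {f : α → List β} {p : α → β → Prop} (hf : Primrec f)
    (hp : PrimrecPred fun x : α × β => p x.1 x.2) : PrimrecPred fun a => ∃ b ∈ f a, p a b := by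
  have h : PrimrecRel fun (b : β) (a : α) => p a b :=
    PrimrecPred.comp hp (Primrec.pair Primrec.snd Primrec.fst)
  exact PrimrecRel.comp h.exists_mem_list hf Primrec.id

theorem primrecPred_mem {f : α → β} {g : α → List β} (hf : Primrec f) (hg : Primrec g) :
    PrimrecPred fun a => f a ∈ g a := by
  refine (primrecPred_exists (p := fun a b => b = f a) hg
    (primrecPred_eq Primrec.snd (hf.comp Primrec.fst))).of_eq fun a => ?_
  simp

theorem primrecPred_imp {p q : α → Prop} (hp : PrimrecPred p) (hq : PrimrecPred q) :
    PrimrecPred fun a => p a → q a :=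
  (hp.not.or hq).of_eq fun a => by tauto

theorem PrimrecPred.primrec_decide {p : α → Prop} [DecidablePred p] (hp : PrimrecPred p) :
    Primrec fun a => decide (p a) :=
  primrecPred_iff_primrec_decide.1 hp

theorem primrec_ite {c : α → Prop} [DecidablePred c] {f g : α → β} (hc : PrimrecPred c)
    (hf : Primrec f) (hg : Primrec g) : Primrec fun a => if c a then f a else g a :=
  Primrec.ite hc hf hg

@[fun_prop]
theorem primrec_letters {f : α → ℕ} (hf : Primrec f) : Primrec fun a => letters (f a) := by
  unfold letters
  refine primrec_cons (by fun_prop) (primrec_flatMap (by fun_prop) ?_)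
  fun_prop

@[fun_prop]
theorem primrec_relators {f : α → Presentation} (hf : Primrec f) :
    Primrec fun a => relators (f a) := by
  unfold relators
  refine primrec_cons (by fun_prop) (primrec_append (primrec_map (by fun_prop)
    (primrec_map (by fun_prop) (by fun_prop))) (primrec_flatMap (by fun_prop) (by fun_prop)))

@[fun_prop]
theorem primrec_allWords {f g : α → ℕ} (hf : Primrec f) (hg : Primrec g) :
    Primrec fun a => allWords (f a) (g a) := by
  have h : Primrec fun a => (Nat.rec [[]] (fun _ W => W.flatMap fun w =>
      (letters (f a)).map fun x => x :: w) (g a) : List (List Letter)) := by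
    refine Primrec.nat_rec' (h := fun a (p : ℕ × List (List Letter)) => p.2.flatMap fun w =>
      (letters (f a)).map fun x => x :: w) hg (Primrec.const _) ?_
    refine primrec_flatMap (by fun_prop) (primrec_map (by fun_prop) (by fun_prop))
  refine h.of_eq fun a => ?_
  generalize g a = L
  induction L with
  | zero => rfl
  | succ L ih => rw [allWords, ← ih]

/-- As a fold, the recursion falls under the closure properties of primitive recursive functions. -/
theorem lifts_eq_foldr (m : ℕ) (δ : Moves) (T : Tracks) (t : Claims) :
    lifts m δ T t = t.foldr (fun c F => F.flatMap fun f => δ.flatMap fun d => T.filterMap fun s =>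
      if d.1 = c.2 ∧ d.2.1 = f.1 ∧ s.1 = c.1 ∧ s.2.2.1 = f.1 then
        some (s.2.1, (s.2.2.2, d.2.2) :: f.2.1, f.2.2) else none)
      ((letters m).map fun z => (z, [], z)) := by
  induction t with
  | nil => rfl
  | cons c t ih => rw [lifts, ih, List.foldr_cons]

theorem primrec_lifts {m : α → ℕ} {δ : α → Moves} {T : α → Tracks} {t : α → Claims}
    (hm : Primrec m) (hδ : Primrec δ) (hT : Primrec T) (ht : Primrec t) :
    Primrec fun a => lifts (m a) (δ a) (T a) (t a) := by
  simp only [lifts_eq_foldr]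
  refine primrec_foldr ht (primrec_map (by fun_prop) (by fun_prop)) ?_
  refine primrec_flatMap (by fun_prop) (primrec_flatMap (by fun_prop)
    (primrec_filterMap (by fun_prop) (primrec_ite ?_ (by fun_prop) (by fun_prop))))
  exact (primrecPred_eq (by fun_prop) (by fun_prop)).and ((primrecPred_eq (by fun_prop)
    (by fun_prop)).and ((primrecPred_eq (by fun_prop) (by fun_prop)).and
      (primrecPred_eq (by fun_prop) (by fun_prop))))

@[fun_prop]
theorem primrec_endpoints {δ : α → Moves} {q : α → ℕ} {w : α → List Letter}
    (hδ : Primrec δ) (hq : Primrec q) (hw : Primrec w) :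
    Primrec fun a => endpoints (δ a) (q a) (w a) := by
  unfold endpoints
  refine primrec_foldr hw (by fun_prop) (primrec_flatMap (by fun_prop)
    (primrec_filterMap (by fun_prop) (primrec_ite ?_ (by fun_prop) (by fun_prop))))
  exact (primrecPred_eq (by fun_prop) (by fun_prop)).and
    (primrecPred_eq (by fun_prop) (by fun_prop))

@[fun_prop]
theorem primrec_loops {m : α → ℕ} {δ : α → Moves} {q k : α → ℕ}
    (hm : Primrec m) (hδ : Primrec δ) (hq : Primrec q) (hk : Primrec k) :
    Primrec fun a => loops (m a) (δ a) (q a) (k a) := by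
  have h : Primrec fun a => (allWords (m a) (k a)).filterMap fun w =>
      if q a ∈ endpoints (δ a) (q a) w then some w else none :=
    primrec_filterMap (by fun_prop) (primrec_ite (primrecPred_mem (by fun_prop) (by fun_prop))
      (by fun_prop) (by fun_prop))
  refine h.of_eq fun a => ?_
  rw [loops, ← List.filterMap_eq_filter]
  refine List.filterMap_congr fun w _ => ?_
  simp [Option.guard]

theorem primrec_applyStep {w : α → List Letter} {s : α → ℕ × List Letter × Bool}
    (hw : Primrec w) (hs : Primrec s) : Primrec fun a => applyStep (w a) (s a) := by
  unfold applyStep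
  exact primrec_ite (primrecPred_eq (by fun_prop) (by fun_prop)) (by fun_prop)
    (primrec_ite (primrecPred_eq (by fun_prop) (by fun_prop)) (by fun_prop) (by fun_prop))

/-- The conjunction displays coherence as built from equalities and memberships by connectives and
quantifiers over lists. -/
theorem isCoherent_iff {P : Presentation} {q₀ : ℕ} {δ : Moves} {T : Tracks}
    {N : List (ℕ × Claims)} {Ω : List (ℕ × Claims × Bool)} : IsCoherent P q₀ δ T N Ω ↔
      (q₀, none, q₀) ∈ δ ∧ (∀ d ∈ δ, d.2.1 ∈ letters P.1) ∧
      (∀ x ∈ letters P.1, ∀ y ∈ letters P.1, ([x], x, y, [y]) ∈ T) ∧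
      (∃ c ∈ N, c.1 = q₀ ∧ Justified P.1 δ T [([none], q₀)] none c.2) ∧
      (∀ c ∈ N, ∀ d ∈ δ, d.1 = c.1 →
        ∃ c' ∈ N, c'.1 = d.2.2 ∧ Justified P.1 δ T c.2 d.2.1 c'.2) ∧
      (∀ c ∈ N, ∀ x ∈ letters P.1, ∃ a ∈ c.2, a.1 = [x]) ∧
      (∀ r ∈ relators P, (q₀, r.map (fun _ => ([none], q₀)), true) ∈ Ω) ∧
      (∀ o ∈ Ω, ∀ d ∈ δ, d.1 = o.1 → ∀ f ∈ lifts P.1 δ T o.2.1, f.1 = d.2.1 →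
        (d.2.2, f.2.1, (o.2.2 && decide (f.1 = f.2.2))) ∈ Ω) ∧
      ∀ o ∈ Ω, ∀ r ∈ relators P, o.2.1.map Prod.fst = r.map (fun a => [a]) → o.2.2 = true :=
  ⟨fun ⟨h1, h2, h3, h4, h5, h6, h7, h8, h9⟩ => ⟨h1, h2, h3, h4, h5, h6, h7, h8, h9⟩,
    fun ⟨h1, h2, h3, h4, h5, h6, h7, h8, h9⟩ => ⟨h1, h2, h3, h4, h5, h6, h7, h8, h9⟩⟩

theorem primrecPred_isCoherent {P : α → Presentation} {q₀ : α → ℕ} {δ : α → Moves}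
    {T : α → Tracks} {N : α → List (ℕ × Claims)} {Ω : α → List (ℕ × Claims × Bool)}
    (hP : Primrec P) (hq : Primrec q₀) (hδ : Primrec δ) (hT : Primrec T) (hN : Primrec N)
    (hΩ : Primrec Ω) :
    PrimrecPred fun a => IsCoherent (P a) (q₀ a) (δ a) (T a) (N a) (Ω a) := by
  simp only [isCoherent_iff]
  repeat' first
    | refine PrimrecPred.and ?_ ?_
    | refine PrimrecPred.not ?_
    | refine primrecPred_forall ?_ ?_
    | refine primrecPred_exists ?_ ?_
    | refine primrecPred_imp ?_ ?_
    | refine primrecPred_mem ?_ ?_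
    | refine primrecPred_eq ?_ ?_
    | refine primrecPred_le ?_ ?_
    | fun_prop
    | refine primrec_lifts ?_ ?_ ?_ ?_
    | refine primrec_map ?_ ?_
    | refine primrec_mk ?_ ?_
    | refine primrec_and ?_ ?_
    | refine PrimrecPred.primrec_decide ?_

theorem primrecPred_isCertificate {P : α → Presentation} {n : α → ℕ} {c : α → Certificate}
    (hP : Primrec P) (hn : Primrec n) (hc : Primrec c) :
    PrimrecPred fun a => IsCertificate (P a) (n a) (c a) := by
  unfold IsCertificate LowerBound UpperBound IsCover
  refine PrimrecPred.and (primrecPred_isCoherent (by fun_prop) (by fun_prop) (by fun_prop)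
    (by fun_prop) (by fun_prop) (by fun_prop)) ?_
  repeat' first
    | refine PrimrecPred.and ?_ ?_
    | refine PrimrecPred.not ?_
    | refine primrecPred_forall ?_ ?_
    | refine primrecPred_exists ?_ ?_
    | refine primrecPred_imp ?_ ?_
    | refine primrecPred_mem ?_ ?_
    | refine primrecPred_eq ?_ ?_
    | refine primrecPred_le ?_ ?_
    | fun_prop
    | refine primrec_foldl ?_ ?_ (primrec_applyStep ?_ ?_)

/-- A nonnegative integer `n` is encoded as `2 * n`. -/
theorem primrec_natCast_int : Primrec fun n : ℕ => (n : ℤ) := by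
  refine Primrec.encode_iff.1 (Primrec.nat_double.of_eq fun n => ?_)
  rfl

open Classical in
/-- The number that a candidate for a certificate yields if it is a certificate. -/
noncomputable def output (x : Presentation × ℕ) (i : ℕ) : Option ℤ :=
  (Encodable.decode (α := Certificate) i).bind fun c =>
    if IsCertificate x.1 x.2 c then some ((c.1 : ℕ) : ℤ) else none

set_option synthInstance.maxSize 2000 in
open Classical in
theorem primrec_output : Primrec₂ output := by
  refine Primrec.option_bind (f := fun x : (Presentation × ℕ) × ℕ =>
      Encodable.decode (α := Certificate) x.2) (Primrec.decode.comp Primrec.snd)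
    (g := fun x c => if IsCertificate x.1.1 x.1.2 c then some ((c.1 : ℕ) : ℤ) else none) ?_
  exact primrec_ite (primrecPred_isCertificate (by fun_prop) (by fun_prop) (by fun_prop))
    (Primrec.option_some.comp (primrec_natCast_int.comp (by fun_prop))) (by fun_prop)

theorem mem_output {x : Presentation × ℕ} {i : ℕ} {p : ℤ} :
    p ∈ output x i ↔ ∃ c : Certificate, c ∈ Encodable.decode (α := Certificate) i ∧
      IsCertificate x.1 x.2 c ∧ ((c.1 : ℕ) : ℤ) = p := by
  simp only [output, Option.mem_def, Option.bind_eq_some_iff, Option.ite_none_right_eq_some,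
    Option.some.injEq]

end PrimitiveRecursion

end FinitePresentation

theorem mainTheorem5 :
    ∃ f : (ℕ × List (List (ℕ × Bool))) × ℕ →. ℤ, Partrec f ∧
      ∀ (m : ℕ) (R : List (FinitePresentation.GenWord m)),
        2 ≤ m → FinitePresentation.IsHyperbolic R →
          ∃ g : ℝ, FinitePresentation.HasGrowthExponent R g ∧
            ∀ n : ℕ, ∃ p ∈ f (FinitePresentation.code R, n),
              |g - (p : ℝ) / 2 ^ n| ≤ 1 / 2 ^ n := by
  refine ⟨fun x => Nat.rfindOpt (FinitePresentation.output x),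
    Partrec.rfindOpt FinitePresentation.primrec_output.to_comp, fun m R hm hR => ?_⟩
  obtain ⟨g, hg⟩ := FinitePresentation.exists_hasGrowthExponent (R := R) hm
  refine ⟨g, hg, fun n => ?_⟩
  obtain ⟨c, hc⟩ := FinitePresentation.exists_isCertificate hm hR n
  have hdom : (Nat.rfindOpt (FinitePresentation.output (FinitePresentation.code R, n))).Dom :=
    Nat.rfindOpt_dom.2 ⟨Encodable.encode c, _, FinitePresentation.mem_output.2
      ⟨c, Encodable.encodek c, hc, rfl⟩⟩
  refine ⟨_, Part.get_mem hdom, ?_⟩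
  -- The certificate found first need not be the one known to exist; soundness applies to any
  -- certificate.
  obtain ⟨i, hi⟩ := Nat.rfindOpt_spec (Part.get_mem hdom)
  obtain ⟨c', -, hc', hp⟩ := FinitePresentation.mem_output.1 hi
  rw [← hp, Int.cast_natCast]
  exact hc'.abs_sub_le hm hg
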